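/- All quantum systems are finite-dimensional. A state is a positive semidefinite operator of trace one; a channel is a completely positive trace-preserving linear map. For states put $T(\rho,\sigma)=\tfrac12\|\rho-\sigma\|_1$, $F(\rho,\sigma)=\mathrm{Tr}\sqrt{\sqrt\rho\,\sigma\sqrt\rho}$ and $D_F(\rho,\sigma)=\sqrt{1-F(\rho,\sigma)^2}$. For a state $\rho$ and a Hermitian operator $X$ on the same system, $\mathcal F_\rho(X)=\mathrm{Tr}[\rho L^2]$ denotes the SLD quantum Fisher information of the family $\{e^{-iXt}\rho e^{iXt}\}_{t}$, where $L$ is any Hermitian operator with $i[\rho,X]=\tfrac12(L\rho+\rho L)$ (such an $L$ exists, and the value does not depend on its choice). Let $A,A',B,B'$ be systems, $X_A,X_{A'},X_B,X_{B'}$ Hermitian operators on them, $\rho_B$ a state on $B$, and $U:A\otimes B\to A'\otimes B'$ a unitary with $$X_A\otimes 1_B+1_A\otimes X_B=U^\dagger(X_{A'}\otimes 1_{B'}+1_{A'}\otimes X_{B'})U .$$ Let $\mathcal E$ be the channel from $A$ to $A'$ given by $\mathcal E(\omega)=\mathrm{Tr}_{B'}[U(\omega\otimes\rho_B)U^\dagger]$,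 let $\mathcal E^\dagger$ be its dual, $\mathrm{Tr}[\mathcal E^\dagger(W)\omega]=\mathrm{Tr}[W\mathcal E(\omega)]$, and put $Y:=X_A-\mathcal E^\dagger(X_{A'})$. Let $\{p_k,\rho_k\}_{k\in K}$ be a test ensemble: $K$ is a finite set, $p_k\ge0$, $\sum_kp_k=1$, and each $\rho_k$ is a state on $A$. Define $$\mathcal C:=\sqrt{\sum_{k\ne k'}p_kp_{k'}\mathrm{Tr}\big[(\rho_k-\rho_{k'})_+\,Y\,(\rho_k-\rho_{k'})_-\,Y\big]},$$ where $(\cdot)_\pm$ are the positive and negative parts, $$\Delta:=\max_{\sigma}\sqrt{\mathcal F_{\sigma\otimes\rho_B}\big(X_A\otimes1_B-U^\dagger(X_{A'}\otimes1_{B'})U\big)},$$ where $\sigma$ runs over the states on $A$ whose support lies in the sum of the supports of the $\rho_k$, and $$\delta:=\min_{\mathcal R}\sqrt{\sum_kp_kD_F(\rho_k,\mathcal R\circ\mathcal E(\rho_k))^2},\qquad \delta_T:=\min_{\mathcal R}\sum_kp_kT(\rho_k,\mathcal R\circ\mathcal E(\rho_k)),$$ where $\mathcal R$ runs over the channels from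 $A'$ to $A$, and $\overline T:=\sqrt{\sum_{k,k'}p_kp_{k'}T(\rho_k,\rho_{k'})^2}$. Then $\overline T\le1$ and $$\frac{\mathcal C}{\Delta+\sqrt{\mathcal F_{\rho_B}(X_B)}}\le\sqrt{\delta_{\rm multi}}\qquad\text{both for }\delta_{\rm multi}=\delta\,\overline T\text{ and for }\delta_{\rm multi}=\delta_T\,(1-\min_kp_k).$$ If the test states are mutually orthogonal, that is, $F(\rho_k,\rho_{k'})=0$ for all $k\neq k'$, then $$\frac{\mathcal C}{\Delta+\sqrt{\mathcal F_{\rho_B}(X_B)}}\le\delta\,\sqrt{1-\min_kp_k}.$$ In particular, $\mathcal C/(\Delta+\sqrt{\mathcal F_{\rho_B}(X_B)})\le\sqrt\delta$ for every test ensemble, and $\mathcal C/(\Delta+\sqrt{\mathcal F_{\rho_B}(X_B)})\le\delta$ for mutually orthogonal test states. If $\Delta+\sqrt{\mathcal F_{\rho_B}(X_B)}=0$, then $\mathcal C=0$, and the quotients are read as $0$. -/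

import Mathlib

open scoped Matrix Kronecker MatrixOrder ComplexOrder

namespace QSI

/-- A density matrix: positive semidefinite with unit trace. -/
structure IsState {n : Type*} [Fintype n] (ρ : Matrix n n ℂ) : Prop where
  posSemidef : ρ.PosSemidef
  trace_eq_one : ρ.trace = 1

/-- `(Φ ⊗ id_r)(M)`: the map `Φ` acts on the first tensor factor. -/
def ampliation {m n r : Type*} (Φ : Matrix m m ℂ →ₗ[ℂ] Matrix n n ℂ)
    (M : Matrix (m × r) (m × r) ℂ) : Matrix (n × r) (n × r) ℂ :=
  Matrix.of fun i j => Φ (Matrix.of fun x y => M (x, i.2) (y, j.2)) i.1 j.1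

/-- A quantum channel: a completely positive and trace preserving linear map. -/
structure IsChannel {m n : Type*} [Fintype m] [Fintype n]
    (Φ : Matrix m m ℂ →ₗ[ℂ] Matrix n n ℂ) : Prop where
  completelyPositive : ∀ (r : ℕ) (M : Matrix (m × Fin r) (m × Fin r) ℂ),
    M.PosSemidef → (ampliation Φ M).PosSemidef
  tracePreserving : ∀ M : Matrix m m ℂ, (Φ M).trace = M.trace

/-- The partial trace over the second tensor factor. -/
def partialTraceRight {m n : Type*} [Fintype n]
    (M : Matrix (m × n) (m × n) ℂ) : Matrix m m ℂ :=
  Matrix.of fun i j => ∑ k, M (i, k) (j, k)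

/-- The dual map `Φ†`, determined by `Tr[Φ†(W) ρ] = Tr[W Φ(ρ)]` (see `trace_dualMap_mul`). -/
def dualMap {m n : Type*} [Fintype n] [DecidableEq m]
    (Φ : Matrix m m ℂ →ₗ[ℂ] Matrix n n ℂ) (W : Matrix n n ℂ) : Matrix m m ℂ :=
  Matrix.of fun i j => (W * Φ (Matrix.single j i 1)).trace

theorem trace_dualMap_mul {m n : Type*} [Fintype m] [Fintype n] [DecidableEq m]
    (Φ : Matrix m m ℂ →ₗ[ℂ] Matrix n n ℂ) (W : Matrix n n ℂ) (ρ : Matrix m m ℂ) :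
    (dualMap Φ W * ρ).trace = (W * Φ ρ).trace := by
  have h : ρ = ∑ i, ∑ j, ρ i j • Matrix.single i j (1 : ℂ) := by
    conv_lhs => rw [Matrix.matrix_eq_sum_single ρ]
    simp [Matrix.smul_single]
  conv_rhs => rw [h]
  simp only [map_sum, map_smul, Matrix.mul_sum, Matrix.trace_sum, Matrix.mul_smul,
    Matrix.trace_smul, smul_eq_mul]
  simp only [Matrix.trace, Matrix.diag, dualMap]
  rw [Finset.sum_comm]
  exact Finset.sum_congr rfl fun i _ => Finset.sum_congr rfl fun j _ => mul_comm _ _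

/-- The trace norm `‖M‖₁ = Tr √(M† M)`. -/
noncomputable def traceNorm {n : Type*} [Fintype n] [DecidableEq n] (M : Matrix n n ℂ) : ℝ :=
  (CFC.sqrt (Mᴴ * M)).trace.re

/-- The trace distance `T(ρ, σ) = ‖ρ - σ‖₁ / 2`. -/
noncomputable def traceDist {n : Type*} [Fintype n] [DecidableEq n] (ρ σ : Matrix n n ℂ) : ℝ :=
  traceNorm (ρ - σ) / 2

/-- The (root) fidelity `F(ρ, σ) = Tr √(√ρ σ √ρ)`. -/
noncomputable def fidelity {n : Type*} [Fintype n] [DecidableEq n] (ρ σ : Matrix n n ℂ) : ℝ :=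
  (CFC.sqrt (CFC.sqrt ρ * σ * CFC.sqrt ρ)).trace.re

/-- The purified distance `D_F(ρ, σ) = √(1 - F(ρ, σ)²)`. -/
noncomputable def purifiedDist {n : Type*} [Fintype n] [DecidableEq n]
    (ρ σ : Matrix n n ℂ) : ℝ :=
  √(1 - fidelity ρ σ ^ 2)

/-- `L` is a symmetric logarithmic derivative at `t = 0` of the family `e^{-iXt} ρ e^{iXt}`, whose
derivative there is `i[ρ, X]`. -/
structure IsSLD {n : Type*} [Fintype n] (ρ X L : Matrix n n ℂ) : Prop where
  isHermitian : L.IsHermitian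
  eq : Complex.I • (ρ * X - X * ρ) = (1 / 2 : ℂ) • (L * ρ + ρ * L)

open Classical in
/-- The SLD quantum Fisher information `Tr[ρ L²]` of the family `e^{-iXt} ρ e^{iXt}`, where `L` is
any symmetric logarithmic derivative: one exists by `exists_isSLD`, and the value does not depend
on it by `qfi_eq`. -/
noncomputable def qfi {n : Type*} [Fintype n] (ρ X : Matrix n n ℂ) : ℝ :=
  if h : ∃ L, IsSLD ρ X L then (ρ * (h.choose * h.choose)).trace.re else 0

theorem exists_isSLD {n : Type*} [Fintype n] [DecidableEq n] {ρ X : Matrix n n ℂ}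
    (hρ : ρ.PosSemidef) (hX : X.IsHermitian) : ∃ L, IsSLD ρ X L := by
  classical
  set V : Matrix n n ℂ := (hρ.1.eigenvectorUnitary : Matrix n n ℂ) with hV
  set l : n → ℝ := hρ.1.eigenvalues with hl
  have hl0 : ∀ i, 0 ≤ l i := hρ.eigenvalues_nonneg
  have hV1 : Vᴴ * V = 1 := by
    simpa [Matrix.star_eq_conjTranspose] using
      (Matrix.mem_unitaryGroup_iff'.1 hρ.1.eigenvectorUnitary.2)
  have hV2 : V * Vᴴ = 1 := by
    simpa [Matrix.star_eq_conjTranspose] using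
      (Matrix.mem_unitaryGroup_iff.1 hρ.1.eigenvectorUnitary.2)
  set D : Matrix n n ℂ := Matrix.diagonal (fun i => (l i : ℂ)) with hD
  have hρD : ρ = V * D * Vᴴ := by
    have := hρ.1.spectral_theorem
    rw [Unitary.conjStarAlgAut_apply] at this
    simpa [Matrix.star_eq_conjTranspose, hD, hV, hl, Function.comp_def] using this
  set X' : Matrix n n ℂ := Vᴴ * X * V with hX'
  have hX'h : X'ᴴ = X' := by
    simp [hX', Matrix.conjTranspose_mul, hX.eq, Matrix.mul_assoc]
  have hXX' : X = V * X' * Vᴴ := by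
    rw [hX']
    calc X = (V * Vᴴ) * X * (V * Vᴴ) := by rw [hV2]; simp
      _ = _ := by simp only [Matrix.mul_assoc]
  set L' : Matrix n n ℂ := Matrix.of fun i j =>
    (2 * Complex.I * ((l i : ℂ) - l j) / ((l i : ℂ) + l j)) * X' i j with hL'
  have hL'h : L'ᴴ = L' := by
    ext i j
    have h1 : star (X' j i) = X' i j := by
      conv_rhs => rw [← hX'h]
      rfl
    simp only [hL', Matrix.conjTranspose_apply, Matrix.of_apply, star_mul', h1]
    congr 1
    simp only [Complex.star_def, map_div₀, map_mul, map_sub, map_add, Complex.conj_I,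
      Complex.conj_ofReal, map_ofNat]
    rw [add_comm (l j : ℂ)]
    ring
  have hkey : Complex.I • (D * X' - X' * D) = (1 / 2 : ℂ) • (L' * D + D * L') := by
    ext i j
    simp only [hD, hL', Matrix.smul_apply, Matrix.sub_apply, Matrix.add_apply,
      Matrix.diagonal_mul, Matrix.mul_diagonal, Matrix.of_apply, smul_eq_mul]
    by_cases h : (l i : ℂ) + l j = 0
    · have h' : l i + l j = 0 := by exact_mod_cast h
      have hi : l i = 0 := by linarith [hl0 i, hl0 j]
      have hj : l j = 0 := by linarith [hl0 i, hl0 j]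
      simp [hi, hj]
    · field_simp
      ring
  have hmul : ∀ P Q : Matrix n n ℂ, (V * P * Vᴴ) * (V * Q * Vᴴ) = V * (P * Q) * Vᴴ := by
    intro P Q
    calc (V * P * Vᴴ) * (V * Q * Vᴴ) = V * P * (Vᴴ * V) * Q * Vᴴ := by
          simp only [Matrix.mul_assoc]
      _ = _ := by rw [hV1]; simp only [Matrix.mul_one, Matrix.mul_assoc]
  refine ⟨V * L' * Vᴴ, ?_, ?_⟩
  · simp [Matrix.IsHermitian, Matrix.conjTranspose_mul, hL'h, Matrix.mul_assoc]
  · rw [hρD, hXX']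
    simp only [hmul]
    rw [← Matrix.sub_mul, ← Matrix.mul_sub, ← Matrix.add_mul, ← Matrix.mul_add,
      ← Matrix.smul_mul, ← Matrix.mul_smul, ← Matrix.smul_mul, ← Matrix.mul_smul, hkey]

theorem qfi_eq {n : Type*} [Fintype n] {ρ X L : Matrix n n ℂ} (hL : IsSLD ρ X L) :
    qfi ρ X = (ρ * (L * L)).trace.re := by
  have h : ∃ L, IsSLD ρ X L := ⟨L, hL⟩
  rw [qfi, dif_pos h]
  have hM : IsSLD ρ X h.choose := h.choose_spec
  generalize h.choose = M at hM ⊢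
  have key : M * ρ + ρ * M = L * ρ + ρ * L := by
    have := hM.eq.symm.trans hL.eq
    exact (smul_right_injective _ (by norm_num : (1 / 2 : ℂ) ≠ 0)) this
  have e1 : ∀ P Q : Matrix n n ℂ, ((P * ρ + ρ * P) * Q).trace = ((Q * ρ + ρ * Q) * P).trace := by
    intro P Q
    simp only [Matrix.add_mul, Matrix.trace_add]
    rw [Matrix.trace_mul_cycle P ρ Q, Matrix.trace_mul_cycle ρ P Q, Matrix.trace_mul_cycle Q P ρ,
      Matrix.trace_mul_cycle ρ Q P, add_comm]
  have e2 : ∀ P : Matrix n n ℂ, ((P * ρ + ρ * P) * P).trace = 2 * (ρ * (P * P)).trace := by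
    intro P
    have h1 : (P * ρ * P).trace = (ρ * (P * P)).trace := by
      rw [Matrix.mul_assoc, Matrix.trace_mul_comm, Matrix.mul_assoc]
    rw [Matrix.add_mul, Matrix.trace_add, h1, Matrix.mul_assoc ρ P P]
    ring
  have e3 : 2 * (ρ * (M * M)).trace = 2 * (ρ * (L * L)).trace := by
    rw [← e2 M, ← e2 L, key, e1 L M, key]
  rw [mul_left_cancel₀ two_ne_zero e3]

/-- The sum of the supports of the states `ρ k` (a positive semidefinite matrix has its range as
its support). -/
def supportSpan {n K : Type*} [Fintype n] (ρ : K → Matrix n n ℂ) : Submodule ℂ (n → ℂ) :=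
  ⨆ k, LinearMap.range (ρ k).mulVecLin

/-- The quantity `Δ`: the maximum of `√𝓕_{σ ⊗ ρB}(X_A ⊗ 1 - U†(X_{A'} ⊗ 1)U)` over the states `σ`
supported in the sum of the supports of the test states. -/
noncomputable def maxFluctuation {a b a' b' K : Type*} [Fintype a] [DecidableEq a]
    [Fintype b] [DecidableEq b] [Fintype a'] [DecidableEq a'] [Fintype b'] [DecidableEq b']
    (XA : Matrix a a ℂ) (XA' : Matrix a' a' ℂ) (U : Matrix (a' × b') (a × b) ℂ)
    (ρB : Matrix b b ℂ) (ρ : K → Matrix a a ℂ) : ℝ :=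
  sSup {x : ℝ | ∃ σ : Matrix a a ℂ, IsState σ ∧ LinearMap.range σ.mulVecLin ≤ supportSpan ρ ∧
    x = √(qfi (σ ⊗ₖ ρB)
      (XA ⊗ₖ (1 : Matrix b b ℂ) - Uᴴ * (XA' ⊗ₖ (1 : Matrix b' b' ℂ)) * U))}

/-- The quantity `𝓒 = √(∑_{k ≠ k'} p_k p_k' Tr[(ρ_k - ρ_k')₊ Y (ρ_k - ρ_k')₋ Y])`. -/
noncomputable def offDiagSum {a K : Type*} [Fintype a] [DecidableEq a] [Fintype K] [DecidableEq K]
    (p : K → ℝ) (ρ : K → Matrix a a ℂ) (Y : Matrix a a ℂ) : ℝ :=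
  √(∑ q ∈ (Finset.univ : Finset K).offDiag,
    p q.1 * p q.2 * ((ρ q.1 - ρ q.2)⁺ * Y * (ρ q.1 - ρ q.2)⁻ * Y).trace.re)

/-- The irreversibility `δ`: the optimal value, over recovery channels `R`, of
`√(∑_k p_k D_F(ρ_k, R(E(ρ_k)))²)`. -/
noncomputable def irreversibility {a a' K : Type*} [Fintype a] [DecidableEq a] [Fintype a']
    [Fintype K] (E : Matrix a a ℂ →ₗ[ℂ] Matrix a' a' ℂ)
    (p : K → ℝ) (ρ : K → Matrix a a ℂ) : ℝ :=
  sInf {x : ℝ | ∃ R : Matrix a' a' ℂ →ₗ[ℂ] Matrix a a ℂ, IsChannel R ∧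
    x = √(∑ k, p k * purifiedDist (ρ k) (R (E (ρ k))) ^ 2)}

/-- The irreversibility `δ_T`: the optimal value, over recovery channels `R`, of
`∑_k p_k T(ρ_k, R(E(ρ_k)))`. -/
noncomputable def traceIrreversibility {a a' K : Type*} [Fintype a] [DecidableEq a] [Fintype a']
    [Fintype K] (E : Matrix a a ℂ →ₗ[ℂ] Matrix a' a' ℂ)
    (p : K → ℝ) (ρ : K → Matrix a a ℂ) : ℝ :=
  sInf {x : ℝ | ∃ R : Matrix a' a' ℂ →ₗ[ℂ] Matrix a a ℂ, IsChannel R ∧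
    x = ∑ k, p k * traceDist (ρ k) (R (E (ρ k)))}

/-- The averaged distinguishability `T̄ = √(∑_{k,k'} p_k p_k' T(ρ_k, ρ_k')²)`. -/
noncomputable def avgTraceDist {a K : Type*} [Fintype a] [DecidableEq a] [Fintype K]
    (p : K → ℝ) (ρ : K → Matrix a a ℂ) : ℝ :=
  √(∑ k, ∑ k', p k * p k' * traceDist (ρ k) (ρ k') ^ 2)

end QSI

/-! Put `Z = X_A ⊗ 1 - U†(X_{A'} ⊗ 1)U`. Conservation says `Z + 1 ⊗ X_B = U†(1 ⊗ X_{B'})U`, so this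
operator commutes with every `G = U†(S ⊗ 1)U`, and `Y` is the marginal of `Z` in the state `ρB`. A
recovery channel `R` that nearly restores `ρ_k` and `ρ_k'` gives such a `G`: take `S = R†(M)`, where
`M` is a projection separating the positive part `P` from the negative part `N` of `ρ_k - ρ_k'`.
Then `G` imitates `M ⊗ 1`, with error `W = G - M ⊗ 1`.

Since `G` commutes with `Z + 1 ⊗ X_B`, and `M ⊗ 1` with `1 ⊗ X_B`, the expectation of `[Y, M]` in
`σ` is, up to sign, that of `[Z, W] + [1 ⊗ X_B, W]` in `σ ⊗ ρB`. The Fisher information uncertainty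
relation (`norm_trace_comm_le`) bounds it by `Γ = Δ + √𝓕(X_B)` times the root of the second moment
of `W` (`norm_trace_comm_le_of_commute`). Superpositions of an eigenvector of `P` with one of `N`
turn this into a bound on matrix elements of `Y` (`norm_matrixElement_sq_le`), and summing over both
spectra bounds `Tr(P Y N Y)` (`re_trace_mul_mul_mul_le`). The noise that appears is at most an error
probability, because `G² ≤ G` (`noise_add_noise_le`).

That probability is a sum of two single-state recovery errors, each at most a trace distance.
Averaging over pairs by Cauchy–Schwarz and Fuchs–van de Graaf gives the bound with `δ T̄`; bounding
the pairwise trace distances by one and dropping the diagonal gives the one with `δ_T (1 - min p)`.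
For orthogonal states `M` detects `ρ_k` with certainty, so each error is at most `1 - F² = D_F²`
rather than `D_F`; this is the gain from `√δ` to `δ`. -/

namespace QSI

/-! ### Traces, pseudo-inverses and spectral decompositions -/

section Trace

variable {m n : Type*} [Fintype m] [Fintype n]

theorem re_trace_mul_conjTranspose (A : Matrix m n ℂ) :
    (A * Aᴴ).trace.re = ∑ i, ∑ j, ‖A i j‖ ^ 2 := by
  simp only [Matrix.trace, Matrix.diag, Matrix.mul_apply, Matrix.conjTranspose_apply,
    Complex.re_sum]
  refine Finset.sum_congr rfl fun i _ => Finset.sum_congr rfl fun j _ => ?_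
  rw [Complex.star_def, Complex.mul_conj, Complex.ofReal_re, Complex.normSq_eq_norm_sq]

/-- The Cauchy–Schwarz inequality for the Hilbert–Schmidt inner product. -/
theorem norm_trace_mul_sq_le (A : Matrix m n ℂ) (B : Matrix n m ℂ) :
    ‖(A * B).trace‖ ^ 2 ≤ (A * Aᴴ).trace.re * (Bᴴ * B).trace.re := by
  have hB : (Bᴴ * B).trace.re = ∑ i, ∑ j, ‖B j i‖ ^ 2 := by
    have := re_trace_mul_conjTranspose Bᴴ
    simpa using this
  rw [re_trace_mul_conjTranspose, hB, ← Fintype.sum_prod_type' (f := fun i j => ‖A i j‖ ^ 2),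
    ← Fintype.sum_prod_type' (f := fun i j => ‖B j i‖ ^ 2)]
  have h : ‖(A * B).trace‖ ≤ ∑ x : m × n, ‖A x.1 x.2‖ * ‖B x.2 x.1‖ := by
    simp only [Matrix.trace, Matrix.diag, Matrix.mul_apply]
    rw [← Fintype.sum_prod_type' (f := fun i j => A i j * B j i)]
    refine (norm_sum_le _ _).trans_eq ?_
    simp
  exact (pow_le_pow_left₀ (norm_nonneg _) h 2).trans
    (Finset.sum_mul_sq_le_sq_mul_sq _ _ _)

theorem exists_hermitian_sqrt [DecidableEq n] {A : Matrix n n ℂ} (hA : A.PosSemidef) :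
    ∃ S : Matrix n n ℂ, Sᴴ = S ∧ S * S = A :=
  ⟨CFC.sqrt A, (Matrix.nonneg_iff_posSemidef.1 (CFC.sqrt_nonneg A)).1,
    CFC.sqrt_mul_sqrt_self A hA.nonneg⟩

theorem re_trace_nonneg {A : Matrix n n ℂ} (hA : A.PosSemidef) : 0 ≤ A.trace.re :=
  (Complex.nonneg_iff.1 hA.trace_nonneg).1

theorem re_trace_mul_nonneg [DecidableEq n] {A B : Matrix n n ℂ} (hA : A.PosSemidef)
    (hB : B.PosSemidef) : 0 ≤ (A * B).trace.re := by
  obtain ⟨S, hS, rfl⟩ := exists_hermitian_sqrt hA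
  rw [Matrix.mul_assoc, Matrix.trace_mul_comm]
  have := re_trace_nonneg (hB.conjTranspose_mul_mul_same S)
  rwa [hS] at this

theorem re_trace_mul_le_of_le [DecidableEq n] {A B C : Matrix n n ℂ} (hA : A.PosSemidef)
    (hBC : (C - B).PosSemidef) : (A * B).trace.re ≤ (A * C).trace.re := by
  have := re_trace_mul_nonneg hA hBC
  rw [Matrix.mul_sub, Matrix.trace_sub, Complex.sub_re] at this
  linarith

theorem im_trace_mul_eq_zero {A B : Matrix n n ℂ} (hA : A.IsHermitian) (hB : B.IsHermitian) :
    (A * B).trace.im = 0 := by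
  have h : star (A * B).trace = (A * B).trace := by
    rw [← Matrix.trace_conjTranspose, Matrix.conjTranspose_mul, hA.eq, hB.eq, Matrix.trace_mul_comm]
  exact Complex.conj_eq_iff_im.1 h

/-- Every Hermitian matrix has a Hermitian pseudo-inverse commuting with it. -/
theorem exists_pseudoInverse [DecidableEq n] {A : Matrix n n ℂ} (hA : A.IsHermitian) :
    ∃ S : Matrix n n ℂ, Sᴴ = S ∧ S * A = A * S ∧ A * S * A = A ∧ S * A * S = S := by
  have hc : ∀ f : ℝ → ℝ, ContinuousOn f (spectrum ℝ A) := fun f =>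
    A.finite_real_spectrum.continuousOn f
  have hsa : IsSelfAdjoint A := hA
  have hid : cfc (id : ℝ → ℝ) A = A := cfc_id ℝ A
  have hm : ∀ f g : ℝ → ℝ, cfc f A * cfc g A = cfc (fun x => f x * g x) A := fun f g =>
    (cfc_mul f g A (hc f) (hc g)).symm
  -- The convention `0⁻¹ = 0` makes this the inverse on the range and zero on the kernel.
  refine ⟨cfc (fun x : ℝ => x⁻¹) A, cfc_predicate (fun x : ℝ => x⁻¹) A, ?_, ?_, ?_⟩
  · conv_lhs => rw [← hid, cfc_id ℝ A]
    nth_rw 2 [← hid]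
    nth_rw 3 [← hid]
    rw [hm, hm]
    simp only [mul_comm]
  · have h : cfc (id : ℝ → ℝ) A * cfc (fun x : ℝ => x⁻¹) A * cfc (id : ℝ → ℝ) A =
        cfc (id : ℝ → ℝ) A := by
      rw [hm, hm]
      congr 1
      ext x
      simp
    rwa [hid] at h
  · nth_rw 2 [← hid]
    rw [hm, hm]
    congr 1
    ext x
    rcases eq_or_ne x 0 with rfl | hx
    · simp
    · simp [hx]

/-- The support projection of a Hermitian matrix. -/
theorem exists_supportProj [DecidableEq n] {A : Matrix n n ℂ} (hA : A.IsHermitian) :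
    ∃ Q : Matrix n n ℂ, Qᴴ = Q ∧ Q * Q = Q ∧ Q * A = A ∧ A * Q = A ∧
      (∀ B : Matrix n n ℂ, A * B = 0 → Q * B = 0) := by
  obtain ⟨S, hS, hc, h1, h2⟩ := exists_pseudoInverse hA
  refine ⟨S * A, ?_, ?_, ?_, ?_, ?_⟩
  · rw [Matrix.conjTranspose_mul, hS, hA.eq, hc]
  · rw [← Matrix.mul_assoc, h2]
  · rw [hc, h1]
  · rw [← Matrix.mul_assoc, h1]
  · intro B hB
    rw [Matrix.mul_assoc, hB, Matrix.mul_zero]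

theorem posSemidef_of_proj {Q : Matrix n n ℂ} (hQ : Qᴴ = Q) (hQ2 : Q * Q = Q) :
    Q.PosSemidef := by
  have := Matrix.posSemidef_conjTranspose_mul_self Q
  rwa [hQ, hQ2] at this

theorem posSemidef_one_sub_proj [DecidableEq n] {Q : Matrix n n ℂ} (hQ : Qᴴ = Q)
    (hQ2 : Q * Q = Q) : (1 - Q).PosSemidef := by
  refine posSemidef_of_proj (by simp [hQ]) ?_
  simp [Matrix.sub_mul, Matrix.mul_sub, hQ2]

/-- Mutual orthogonality of the eigenvectors is not recorded: later only the unit norm, the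
eigenvalue equation and the rank-one expansion enter. -/
theorem exists_spectral_decomposition [DecidableEq n] {A : Matrix n n ℂ} (hA : A.PosSemidef) :
    ∃ (l : n → ℝ) (u : n → n → ℂ), (∀ i, 0 ≤ l i) ∧ (∀ i, star (u i) ⬝ᵥ u i = 1) ∧
      (∀ i, A *ᵥ u i = (l i : ℂ) • u i) ∧
      A = ∑ i, (l i : ℂ) • Matrix.vecMulVec (u i) (star (u i)) := by
  set V : Matrix n n ℂ := (hA.1.eigenvectorUnitary : Matrix n n ℂ) with hV
  have hV1 : Vᴴ * V = 1 := by
    simpa [Matrix.star_eq_conjTranspose] using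
      (Matrix.mem_unitaryGroup_iff'.1 hA.1.eigenvectorUnitary.2)
  set l := hA.1.eigenvalues with hl
  have hAD : A = V * Matrix.diagonal (fun i => (l i : ℂ)) * Vᴴ := by
    have := hA.1.spectral_theorem
    rw [Unitary.conjStarAlgAut_apply] at this
    simpa [Matrix.star_eq_conjTranspose, hV, hl, Function.comp_def] using this
  refine ⟨l, fun i j => V j i, hA.eigenvalues_nonneg, fun i => ?_, fun i => ?_, ?_⟩
  · have := congrFun (congrFun hV1 i) i
    simpa [Matrix.mul_apply, dotProduct] using this
  · have h : A * V = V * Matrix.diagonal (fun i => (l i : ℂ)) := by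
      rw [hAD, Matrix.mul_assoc, hV1, Matrix.mul_one]
    ext j
    have := congrFun (congrFun h j) i
    rw [Matrix.mul_diagonal] at this
    simpa [Matrix.mul_apply, Matrix.mulVec, dotProduct, mul_comm] using this
  · conv_lhs => rw [hAD]
    ext j k
    simp [Matrix.mul_apply, Matrix.sum_apply, Matrix.vecMulVec_apply, Matrix.diagonal_apply]
    refine Finset.sum_congr rfl fun i _ => by ring

end Trace

/-! ### Trace distance and its optimal test -/

section TraceDistance

variable {n : Type*} [Fintype n]

theorem isHermitian_state_sub {ρ σ : Matrix n n ℂ} (hρ : IsState ρ) (hσ : IsState σ) :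
    (ρ - σ).IsHermitian := hρ.posSemidef.1.sub hσ.posSemidef.1

theorem trace_state_sub {ρ σ : Matrix n n ℂ} (hρ : IsState ρ) (hσ : IsState σ) :
    (ρ - σ).trace = 0 := by
  rw [Matrix.trace_sub, hρ.trace_eq_one, hσ.trace_eq_one, sub_self]

variable [DecidableEq n]

theorem traceNorm_eq {D : Matrix n n ℂ} (hD : D.IsHermitian) :
    traceNorm D = (D⁺).trace.re + (D⁻).trace.re := by
  have h := CFC.posPart_add_negPart D hD
  rw [← Complex.add_re, ← Matrix.trace_add, h]
  rfl

theorem re_trace_posPart {D : Matrix n n ℂ} (hD : D.IsHermitian) (h0 : D.trace = 0) :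
    (D⁺).trace.re = traceNorm D / 2 ∧ (D⁻).trace.re = traceNorm D / 2 := by
  have h := congrArg (fun M : Matrix n n ℂ => M.trace.re) (CFC.posPart_sub_negPart D hD)
  simp only [Matrix.trace_sub, h0, Complex.sub_re, Complex.zero_re] at h
  rw [traceNorm_eq hD]
  constructor <;> linarith

theorem posSemidef_posPart (D : Matrix n n ℂ) : (D⁺).PosSemidef :=
  Matrix.nonneg_iff_posSemidef.1 (CFC.posPart_nonneg D)

theorem posSemidef_negPart (D : Matrix n n ℂ) : (D⁻).PosSemidef :=
  Matrix.nonneg_iff_posSemidef.1 (CFC.negPart_nonneg D)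

/-- The trace distance bounds the difference of the probabilities of an effect. -/
theorem re_trace_sub_mul_le_traceDist {ρ σ : Matrix n n ℂ} (hρ : IsState ρ) (hσ : IsState σ)
    {Q : Matrix n n ℂ} (hQ : Q.PosSemidef) (hQ1 : (1 - Q).PosSemidef) :
    ((ρ - σ) * Q).trace.re ≤ traceDist ρ σ := by
  have hD := isHermitian_state_sub hρ hσ
  have h := CFC.posPart_sub_negPart (ρ - σ) hD
  have h1 : ((ρ - σ) * Q).trace.re = ((ρ - σ)⁺ * Q).trace.re - ((ρ - σ)⁻ * Q).trace.re := by
    rw [← Complex.sub_re, ← Matrix.trace_sub, ← Matrix.sub_mul, h]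
  have h2 := re_trace_mul_nonneg (posSemidef_negPart (ρ - σ)) hQ
  have h3 := re_trace_mul_le_of_le (posSemidef_posPart (ρ - σ)) hQ1
  rw [Matrix.mul_one, (re_trace_posPart hD (trace_state_sub hρ hσ)).1] at h3
  rw [traceDist]
  linarith

theorem traceDist_comm (ρ σ : Matrix n n ℂ) : traceDist ρ σ = traceDist σ ρ := by
  rw [traceDist, traceDist, ← neg_sub σ ρ, traceNorm, traceNorm,
    Matrix.conjTranspose_neg, neg_mul_neg]

/-- The trace distance is attained on a projection. -/
theorem exists_proj_traceDist {ρ σ : Matrix n n ℂ} (hρ : IsState ρ) (hσ : IsState σ) :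
    ∃ Q : Matrix n n ℂ, Qᴴ = Q ∧ Q * Q = Q ∧ Q * (ρ - σ)⁺ = (ρ - σ)⁺ ∧
      (ρ - σ)⁺ * Q = (ρ - σ)⁺ ∧ Q * (ρ - σ)⁻ = 0 ∧ (ρ - σ)⁻ * Q = 0 ∧
      ((ρ - σ) * Q).trace.re = traceDist ρ σ := by
  obtain ⟨Q, hQ, hQ2, hQP, hPQ, hQ0⟩ := exists_supportProj (posSemidef_posPart (ρ - σ)).1
  -- The support projection of the positive part annihilates the negative part because the two parts
  -- have product zero.
  have hQN := hQ0 _ (CFC.posPart_mul_negPart (ρ - σ))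
  have hNQ : (ρ - σ)⁻ * Q = 0 := by
    have := congrArg Matrix.conjTranspose hQN
    rwa [Matrix.conjTranspose_mul, hQ, (posSemidef_negPart (ρ - σ)).1.eq,
      Matrix.conjTranspose_zero] at this
  refine ⟨Q, hQ, hQ2, hQP, hPQ, hQN, hNQ, ?_⟩
  have hD := isHermitian_state_sub hρ hσ
  conv_lhs => rw [← CFC.posPart_sub_negPart (ρ - σ) hD, Matrix.sub_mul, hNQ, hPQ, sub_zero]
  exact (re_trace_posPart hD (trace_state_sub hρ hσ)).1

theorem traceDist_nonneg {ρ σ : Matrix n n ℂ} (hρ : IsState ρ) (hσ : IsState σ) :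
    0 ≤ traceDist ρ σ := by
  rw [traceDist, ← (re_trace_posPart (isHermitian_state_sub hρ hσ) (trace_state_sub hρ hσ)).1]
  exact re_trace_nonneg (posSemidef_posPart _)

theorem re_trace_state_mul_le_one {ρ Q : Matrix n n ℂ} (hρ : IsState ρ)
    (hQ1 : (1 - Q).PosSemidef) : (ρ * Q).trace.re ≤ 1 := by
  have := re_trace_mul_le_of_le hρ.posSemidef hQ1
  rwa [Matrix.mul_one, hρ.trace_eq_one, Complex.one_re] at this

theorem traceDist_le_one {ρ σ : Matrix n n ℂ} (hρ : IsState ρ) (hσ : IsState σ) :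
    traceDist ρ σ ≤ 1 := by
  obtain ⟨Q, hQ, hQ2, -, -, -, -, h⟩ := exists_proj_traceDist hρ hσ
  rw [← h, Matrix.sub_mul, Matrix.trace_sub, Complex.sub_re]
  linarith [re_trace_state_mul_le_one hρ (posSemidef_one_sub_proj hQ hQ2),
    re_trace_mul_nonneg hσ.posSemidef (posSemidef_of_proj hQ hQ2)]

end TraceDistance

/-! ### Fidelity, projective measurements and Fuchs–van de Graaf -/

section Fidelity

variable {n : Type*} [Fintype n] [DecidableEq n]

/-- The trace of `|K|` is `Tr (W K)` for some contraction `W`. -/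
theorem exists_contraction_trace_sqrt (K : Matrix n n ℂ) :
    ∃ W : Matrix n n ℂ, (1 - W * Wᴴ).PosSemidef ∧ CFC.sqrt (Kᴴ * K) = W * K := by
  have hK := Matrix.posSemidef_conjTranspose_mul_self K
  set R := CFC.sqrt (Kᴴ * K) with hR
  have hRh : Rᴴ = R := (Matrix.nonneg_iff_posSemidef.1 (CFC.sqrt_nonneg (Kᴴ * K))).1
  have hRR : R * R = Kᴴ * K := CFC.sqrt_mul_sqrt_self (Kᴴ * K) hK.nonneg
  obtain ⟨S, hS, hc, h1, h2⟩ := exists_pseudoInverse (A := R) hRh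
  -- Polar decomposition: with `S` the pseudo-inverse of `R = |K|`, `W = S K†` satisfies `W K = S R²
  -- = R`, and `W W† = S R` is the support projection of `R`.
  refine ⟨S * Kᴴ, ?_, ?_⟩
  · have h3 : S * Kᴴ * (S * Kᴴ)ᴴ = S * R := by
      rw [Matrix.conjTranspose_mul, Matrix.conjTranspose_conjTranspose, hS]
      calc S * Kᴴ * (K * S) = S * (Kᴴ * K) * S := by simp only [Matrix.mul_assoc]
        _ = S * R * (R * S) := by rw [← hRR]; simp only [Matrix.mul_assoc]
        _ = S * R * S * R := by rw [← hc]; simp only [Matrix.mul_assoc]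
        _ = S * R := by rw [h2]
    rw [h3]
    refine posSemidef_one_sub_proj ?_ ?_
    · rw [Matrix.conjTranspose_mul, hS, hRh, hc]
    · rw [← Matrix.mul_assoc, h2]
  · rw [Matrix.mul_assoc, ← hRR, ← Matrix.mul_assoc, hc, h1]

theorem fidelity_nonneg (ρ σ : Matrix n n ℂ) : 0 ≤ fidelity ρ σ :=
  re_trace_nonneg (Matrix.nonneg_iff_posSemidef.1 (CFC.sqrt_nonneg _))

/-- The fidelity is bounded by the classical fidelity of any two-outcome projective
measurement. -/
theorem fidelity_le_of_proj {ρ σ Q : Matrix n n ℂ} (hρ : ρ.PosSemidef) (hσ : σ.PosSemidef)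
    (hQ : Qᴴ = Q) (hQ2 : Q * Q = Q) :
    fidelity ρ σ ≤ √((ρ * Q).trace.re * (σ * Q).trace.re) +
      √((ρ * (1 - Q)).trace.re * (σ * (1 - Q)).trace.re) := by
  set A := CFC.sqrt ρ with hA
  set B := CFC.sqrt σ with hB
  have hAh : Aᴴ = A := (Matrix.nonneg_iff_posSemidef.1 (CFC.sqrt_nonneg ρ)).1
  have hBh : Bᴴ = B := (Matrix.nonneg_iff_posSemidef.1 (CFC.sqrt_nonneg σ)).1
  have hAA : A * A = ρ := CFC.sqrt_mul_sqrt_self ρ hρ.nonneg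
  have hBB : B * B = σ := CFC.sqrt_mul_sqrt_self σ hσ.nonneg
  obtain ⟨W, hW, hWK⟩ := exists_contraction_trace_sqrt (B * A)
  have hF : fidelity ρ σ = (W * (B * A)).trace.re := by
    rw [← hWK, fidelity, ← hA, Matrix.conjTranspose_mul, hAh, hBh, ← hBB]
    simp only [Matrix.mul_assoc]
  -- Write the middle `P` as `P * P`, apply Cauchy–Schwarz to `P A W` and `B P`, and remove `W W†`
  -- by contractivity.
  have key : ∀ P : Matrix n n ℂ, Pᴴ = P → P * P = P →
      (W * (B * P * A)).trace.re ≤ √((ρ * P).trace.re * (σ * P).trace.re) := by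
    intro P hP hP2
    refine Real.le_sqrt_of_sq_le ?_
    have h1 := norm_trace_mul_sq_le (P * A * W) (B * P)
    have h2 : (P * A * W * (B * P)).trace = (W * (B * P * A)).trace := by
      rw [Matrix.mul_assoc (P * A), Matrix.trace_mul_comm (P * A)]
      congr 1
      calc W * (B * P) * (P * A) = W * (B * (P * P) * A) := by simp only [Matrix.mul_assoc]
        _ = _ := by rw [hP2]
    have h3 : ((B * P)ᴴ * (B * P)).trace = (σ * P).trace := by
      rw [Matrix.conjTranspose_mul, hP, hBh]
      calc (P * B * (B * P)).trace = (P * (B * B * P)).trace := by simp only [Matrix.mul_assoc]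
        _ = (B * B * (P * P)).trace := by rw [Matrix.trace_mul_comm, Matrix.mul_assoc]
        _ = _ := by rw [hBB, hP2]
    have h4 : (P * A * W * (P * A * W)ᴴ).trace = (A * P * A * (W * Wᴴ)).trace := by
      rw [Matrix.conjTranspose_mul, Matrix.conjTranspose_mul, hAh, hP]
      calc (P * A * W * (Wᴴ * (A * P))).trace = (P * A * (W * Wᴴ) * (A * P)).trace := by
            simp only [Matrix.mul_assoc]
        _ = (A * (P * P) * A * (W * Wᴴ)).trace := by
            rw [Matrix.trace_mul_comm]; simp only [Matrix.mul_assoc]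
        _ = _ := by rw [hP2]
    have hpsd : (A * P * A).PosSemidef := by
      have := (posSemidef_of_proj hP hP2).conjTranspose_mul_mul_same A
      rwa [hAh] at this
    have h5 := re_trace_mul_le_of_le hpsd hW
    have h6 : (A * P * A * 1).trace = (ρ * P).trace := by
      rw [Matrix.mul_one, Matrix.trace_mul_comm, ← Matrix.mul_assoc, hAA]
    rw [h2, h3, h4] at h1
    rw [h6] at h5
    have h7 : 0 ≤ (σ * P).trace.re := re_trace_mul_nonneg hσ (posSemidef_of_proj hP hP2)
    calc (W * (B * P * A)).trace.re ^ 2 ≤ ‖(W * (B * P * A)).trace‖ ^ 2 := by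
          rw [← sq_abs]
          exact pow_le_pow_left₀ (abs_nonneg _) (Complex.abs_re_le_norm _) 2
      _ ≤ _ := h1.trans (mul_le_mul_of_nonneg_right h5 h7)
  have hsplit : (W * (B * A)).trace.re =
      (W * (B * Q * A)).trace.re + (W * (B * (1 - Q) * A)).trace.re := by
    rw [← Complex.add_re, ← Matrix.trace_add, ← Matrix.mul_add, ← Matrix.add_mul, ← Matrix.mul_add]
    simp
  rw [hF, hsplit]
  refine add_le_add (key Q hQ hQ2) (key (1 - Q) (by simp [hQ]) ?_)
  simp [Matrix.sub_mul, Matrix.mul_sub, hQ2]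

theorem re_trace_mul_one_sub {ρ : Matrix n n ℂ} (hρ : IsState ρ) (Q : Matrix n n ℂ) :
    (ρ * (1 - Q)).trace.re = 1 - (ρ * Q).trace.re := by
  rw [Matrix.mul_sub, Matrix.trace_sub, Matrix.mul_one, hρ.trace_eq_one, Complex.sub_re,
    Complex.one_re]

/-- One half of the Fuchs–van de Graaf inequalities. -/
theorem traceDist_sq_le {ρ σ : Matrix n n ℂ} (hρ : IsState ρ) (hσ : IsState σ) :
    traceDist ρ σ ^ 2 ≤ 1 - fidelity ρ σ ^ 2 := by
  obtain ⟨Q, hQ, hQ2, -, -, -, -, h⟩ := exists_proj_traceDist hρ hσ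
  have hF := fidelity_le_of_proj hρ.posSemidef hσ.posSemidef hQ hQ2
  rw [re_trace_mul_one_sub hρ, re_trace_mul_one_sub hσ] at hF
  rw [Matrix.sub_mul, Matrix.trace_sub, Complex.sub_re] at h
  have hq0 := re_trace_mul_nonneg hρ.posSemidef (posSemidef_of_proj hQ hQ2)
  have hr0 := re_trace_mul_nonneg hσ.posSemidef (posSemidef_of_proj hQ hQ2)
  have hq1 := re_trace_state_mul_le_one hρ (posSemidef_one_sub_proj hQ hQ2)
  have hr1 := re_trace_state_mul_le_one hσ (posSemidef_one_sub_proj hQ hQ2)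
  generalize (ρ * Q).trace.re = q at *
  generalize (σ * Q).trace.re = r at *
  have h1 := Real.sq_sqrt (mul_nonneg hq0 hr0)
  have h2 := Real.sq_sqrt (mul_nonneg (sub_nonneg.2 hq1) (sub_nonneg.2 hr1))
  set x := √(q * r)
  set y := √((1 - q) * (1 - r))
  -- AM–GM for `q(1 - q)` and `r(1 - r)`. Inserted in `(x + y)²` it leaves exactly `1 - (q - r)²`.
  have hxy : 2 * (x * y) ≤ q * (1 - q) + r * (1 - r) := by
    have h3 : (2 * (x * y)) ^ 2 ≤ (q * (1 - q) + r * (1 - r)) ^ 2 := by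
      have : (2 * (x * y)) ^ 2 = 4 * (x ^ 2 * y ^ 2) := by ring
      rw [this, h1, h2]
      nlinarith [sq_nonneg (q * (1 - q) - r * (1 - r))]
    refine le_of_sq_le_sq h3 ?_
    nlinarith [mul_nonneg hq0 (sub_nonneg.2 hq1), mul_nonneg hr0 (sub_nonneg.2 hr1)]
  have h4 : fidelity ρ σ ^ 2 ≤ (x + y) ^ 2 := pow_le_pow_left₀ (fidelity_nonneg ρ σ) hF 2
  rw [← h]
  nlinarith

theorem fidelity_sq_le_one {ρ σ : Matrix n n ℂ} (hρ : IsState ρ) (hσ : IsState σ) :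
    fidelity ρ σ ^ 2 ≤ 1 := by
  linarith [traceDist_sq_le hρ hσ, sq_nonneg (traceDist ρ σ)]

theorem purifiedDist_sq {ρ σ : Matrix n n ℂ} (hρ : IsState ρ) (hσ : IsState σ) :
    purifiedDist ρ σ ^ 2 = 1 - fidelity ρ σ ^ 2 :=
  Real.sq_sqrt (sub_nonneg.2 (fidelity_sq_le_one hρ hσ))

/-- A projection dominating the support of `ρ` detects `σ` with probability at least
`F(ρ, σ)²`. -/
theorem fidelity_sq_le_of_proj {ρ σ Q : Matrix n n ℂ} (hρ : IsState ρ) (hσ : IsState σ)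
    (hQ : Qᴴ = Q) (hQ2 : Q * Q = Q) (hρQ : ρ * Q = ρ) :
    fidelity ρ σ ^ 2 ≤ (σ * Q).trace.re := by
  have hF := fidelity_le_of_proj hρ.posSemidef hσ.posSemidef hQ hQ2
  have hr0 := re_trace_mul_nonneg hσ.posSemidef (posSemidef_of_proj hQ hQ2)
  rw [re_trace_mul_one_sub hρ, hρQ, hρ.trace_eq_one, Complex.one_re, sub_self, zero_mul,
    Real.sqrt_zero, add_zero, one_mul] at hF
  exact (pow_le_pow_left₀ (fidelity_nonneg ρ σ) hF 2).trans_eq (Real.sq_sqrt hr0)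

/-- A positive semidefinite matrix of trace zero vanishes, so `√ρ σ √ρ = 0`; this is `K†K` for `K =
√σ √ρ`, whence `K = 0`. -/
theorem mul_eq_zero_of_fidelity_eq_zero {ρ σ : Matrix n n ℂ} (hρ : ρ.PosSemidef)
    (hσ : σ.PosSemidef) (h : fidelity ρ σ = 0) : ρ * σ = 0 := by
  set A := CFC.sqrt ρ with hA
  set B := CFC.sqrt σ with hB
  have hAh : Aᴴ = A := (Matrix.nonneg_iff_posSemidef.1 (CFC.sqrt_nonneg ρ)).1
  have hBh : Bᴴ = B := (Matrix.nonneg_iff_posSemidef.1 (CFC.sqrt_nonneg σ)).1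
  have hAA : A * A = ρ := CFC.sqrt_mul_sqrt_self ρ hρ.nonneg
  have hBB : B * B = σ := CFC.sqrt_mul_sqrt_self σ hσ.nonneg
  have hpsd : (A * σ * A).PosSemidef := by
    have := hσ.conjTranspose_mul_mul_same A
    rwa [hAh] at this
  have hS := Matrix.nonneg_iff_posSemidef.1 (CFC.sqrt_nonneg (A * σ * A))
  have hS0 : (CFC.sqrt (A * σ * A)).trace = 0 :=
    Complex.ext h (Complex.nonneg_iff.1 hS.trace_nonneg).2.symm
  have h1 : A * σ * A = 0 := by
    rw [← CFC.sqrt_mul_sqrt_self _ hpsd.nonneg, hS.trace_eq_zero_iff.1 hS0, Matrix.mul_zero]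
  have h2 : B * A = 0 := by
    rw [← Matrix.conjTranspose_mul_self_eq_zero, Matrix.conjTranspose_mul, hAh, hBh]
    rw [← h1, ← hBB]
    simp only [Matrix.mul_assoc]
  have h3 : A * B = 0 := by
    have := congrArg Matrix.conjTranspose h2
    rwa [Matrix.conjTranspose_mul, hAh, hBh, Matrix.conjTranspose_zero] at this
  rw [← hAA, ← hBB, Matrix.mul_assoc, ← Matrix.mul_assoc A B, h3]
  simp

end Fidelity

/-! ### Quantum Fisher information -/

section Fisher

variable {m n : Type*} [Fintype m] [Fintype n]

/-- Cauchy–Schwarz for the form weighted by `η`, obtained by splitting `η` into two square roots. -/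
theorem norm_trace_state_mul_sq_le [DecidableEq n] {η A B : Matrix n n ℂ} (hη : η.PosSemidef)
    (hA : A.IsHermitian) (hB : B.IsHermitian) :
    ‖(η * (A * B)).trace‖ ^ 2 ≤ (η * (A * A)).trace.re * (η * (B * B)).trace.re := by
  obtain ⟨S, hS, rfl⟩ := exists_hermitian_sqrt hη
  have h := norm_trace_mul_sq_le (S * A) (B * S)
  have h1 : (S * A * (B * S)).trace = (S * S * (A * B)).trace := by
    rw [← Matrix.mul_assoc (S * A), Matrix.trace_mul_comm]
    simp only [Matrix.mul_assoc]
  have h2 : (S * A * (S * A)ᴴ).trace = (S * S * (A * A)).trace := by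
    rw [Matrix.conjTranspose_mul, hS, hA.eq, ← Matrix.mul_assoc (S * A), Matrix.trace_mul_comm]
    simp only [Matrix.mul_assoc]
  have h3 : ((B * S)ᴴ * (B * S)).trace = (S * S * (B * B)).trace := by
    rw [Matrix.conjTranspose_mul, hS, hB.eq, ← Matrix.mul_assoc (S * B), Matrix.trace_mul_comm]
    simp only [Matrix.mul_assoc]
  rwa [h1, h2, h3] at h

theorem qfi_nonneg [DecidableEq n] {η X : Matrix n n ℂ} (hη : η.PosSemidef)
    (hX : X.IsHermitian) : 0 ≤ qfi η X := by
  obtain ⟨L, hL⟩ := exists_isSLD hη hX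
  rw [qfi_eq hL]
  refine re_trace_mul_nonneg hη ?_
  have := Matrix.posSemidef_conjTranspose_mul_self L
  rwa [hL.isHermitian.eq] at this

theorem trace_comm_mul (η X W : Matrix n n ℂ) :
    (η * (X * W - W * X)).trace = ((η * X - X * η) * W).trace := by
  simp only [Matrix.mul_sub, Matrix.sub_mul, Matrix.trace_sub]
  rw [← Matrix.mul_assoc, ← Matrix.mul_assoc, Matrix.trace_mul_comm (η * W), Matrix.mul_assoc X]

/-- The uncertainty relation between the quantum Fisher information of `X` and the second moment
of `W`. -/
theorem norm_trace_comm_le [DecidableEq n] {η X W : Matrix n n ℂ} (hη : η.PosSemidef)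
    (hX : X.IsHermitian) (hW : W.IsHermitian) :
    ‖(η * (X * W - W * X)).trace‖ ≤ √(qfi η X) * √(η * (W * W)).trace.re := by
  obtain ⟨L, hL⟩ := exists_isSLD hη hX
  have hq := qfi_nonneg hη hX
  rw [← Real.sqrt_mul hq]
  refine Real.le_sqrt_of_sq_le ?_
  rw [qfi_eq hL]
  refine le_trans (pow_le_pow_left₀ (norm_nonneg _) ?_ 2)
    (norm_trace_state_mul_sq_le hη hL.isHermitian hW)
  set z := (η * (L * W)).trace with hz
  have hz' : (L * η * W).trace = star z := by
    rw [hz, ← Matrix.trace_conjTranspose, Matrix.conjTranspose_mul, Matrix.conjTranspose_mul,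
      hL.isHermitian.eq, hW.eq, hη.1.eq, Matrix.mul_assoc, Matrix.mul_assoc,
      Matrix.trace_mul_comm W, Matrix.mul_assoc]
  -- The defining equation of `L` replaces the commutator by half an anticommutator, so the
  -- expectation becomes the real part of `z`.
  have h : Complex.I * (η * (X * W - W * X)).trace = (1 / 2 : ℂ) * (star z + z) := by
    rw [trace_comm_mul, ← smul_eq_mul, ← Matrix.trace_smul, ← Matrix.smul_mul, hL.eq,
      Matrix.smul_mul, Matrix.trace_smul, smul_eq_mul, Matrix.add_mul, Matrix.trace_add, hz',
      Matrix.mul_assoc η]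
  have h1 : ‖(η * (X * W - W * X)).trace‖ = ‖(1 / 2 : ℂ) * (star z + z)‖ := by
    rw [← h, norm_mul, Complex.norm_I, one_mul]
  rw [h1, norm_mul]
  have h2 := norm_add_le (star z) z
  rw [norm_star] at h2
  have h3 : ‖(1 / 2 : ℂ)‖ = 1 / 2 := by norm_num
  rw [h3]
  linarith

/-- With `z = Tr(η X L)`, the defining equation gives `𝓕 ≤ 2‖z‖`, while Cauchy–Schwarz gives `‖z‖² ≤
Tr(η X²) 𝓕`; cancel one factor `𝓕`. It serves to bound the set whose supremum is `Δ`. -/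
theorem qfi_le [DecidableEq n] {η X : Matrix n n ℂ} (hη : η.PosSemidef) (hX : X.IsHermitian) :
    qfi η X ≤ 4 * (η * (X * X)).trace.re := by
  obtain ⟨L, hL⟩ := exists_isSLD hη hX
  have hq := qfi_nonneg hη hX
  have hc := norm_trace_state_mul_sq_le hη hX hL.isHermitian
  rw [← qfi_eq hL] at hc
  set z := (η * (X * L)).trace with hz
  have h1 : (η * (L * X)).trace = star z := by
    rw [hz, ← Matrix.trace_conjTranspose, Matrix.conjTranspose_mul, Matrix.conjTranspose_mul,
      hL.isHermitian.eq, hX.eq, hη.1.eq, Matrix.trace_mul_comm]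
  have h2 : Complex.I * (z - star z) = (η * (L * L)).trace := by
    rw [hz, ← h1, ← Matrix.trace_sub, ← Matrix.mul_sub, trace_comm_mul, ← smul_eq_mul,
      ← Matrix.trace_smul, ← Matrix.smul_mul, hL.eq, Matrix.smul_mul, Matrix.trace_smul,
      Matrix.add_mul, Matrix.trace_add, Matrix.mul_assoc L, Matrix.trace_mul_comm L,
      Matrix.mul_assoc, smul_eq_mul]
    ring
  have h3 : qfi η X ≤ 2 * ‖z‖ := by
    rw [qfi_eq hL, ← h2]
    refine (Complex.re_le_norm _).trans ?_
    rw [norm_mul, Complex.norm_I, one_mul]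
    refine (norm_sub_le _ _).trans ?_
    rw [norm_star]
    linarith
  rcases hq.eq_or_lt with h0 | h0
  · rw [← h0]
    have : 0 ≤ (η * (X * X)).trace.re := by
      refine re_trace_mul_nonneg hη ?_
      have := Matrix.posSemidef_conjTranspose_mul_self X
      rwa [hX.eq] at this
    linarith
  · nlinarith [norm_nonneg z]

theorem trace_vecMulVec_mul (u v : n → ℂ) (M : Matrix n n ℂ) :
    (Matrix.vecMulVec u v * M).trace = v ⬝ᵥ (M *ᵥ u) := by
  rw [Matrix.vecMulVec_mul, Matrix.trace_vecMulVec, Matrix.dotProduct_mulVec, dotProduct_comm]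

theorem vecMulVec_star_proj {u : n → ℂ} (hu : star u ⬝ᵥ u = 1) :
    (Matrix.vecMulVec u (star u))ᴴ = Matrix.vecMulVec u (star u) ∧
      Matrix.vecMulVec u (star u) * Matrix.vecMulVec u (star u) =
        Matrix.vecMulVec u (star u) := by
  constructor
  · rw [Matrix.conjTranspose_vecMulVec, star_star]
  · rw [Matrix.vecMulVec_mul_vecMulVec, hu, one_smul]

theorem re_trace_state_mul_le_trace [DecidableEq n] {ρ M : Matrix n n ℂ} (hρ : IsState ρ)
    (hM : M.PosSemidef) : (ρ * M).trace.re ≤ M.trace.re := by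
  obtain ⟨l, u, hl, hu, -, h⟩ := exists_spectral_decomposition hM
  rw [h]
  simp only [Matrix.mul_sum, Matrix.trace_sum, Complex.re_sum, Matrix.mul_smul, Matrix.trace_smul,
    smul_eq_mul, Complex.re_ofReal_mul]
  refine Finset.sum_le_sum fun i _ => mul_le_mul_of_nonneg_left ?_ (hl i)
  obtain ⟨h1, h2⟩ := vecMulVec_star_proj (hu i)
  refine (re_trace_state_mul_le_one hρ (posSemidef_one_sub_proj h1 h2)).trans_eq ?_
  rw [Matrix.trace_vecMulVec, dotProduct_comm, hu i, Complex.one_re]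

theorem isState_kronecker {ρ : Matrix m m ℂ} {σ : Matrix n n ℂ} (hρ : IsState ρ)
    (hσ : IsState σ) : IsState (ρ ⊗ₖ σ) :=
  ⟨hρ.posSemidef.kronecker hσ.posSemidef, by
    rw [Matrix.trace_kronecker, hρ.trace_eq_one, hσ.trace_eq_one, one_mul]⟩

/-- If `L` is a logarithmic derivative for `ρ` and `X`, then `1 ⊗ L` is one for the product. -/
theorem qfi_one_kronecker [DecidableEq m] [DecidableEq n] {σ : Matrix m m ℂ} {ρ X : Matrix n n ℂ}
    (hσ : IsState σ) (hρ : ρ.PosSemidef) (hX : X.IsHermitian) :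
    qfi (σ ⊗ₖ ρ) ((1 : Matrix m m ℂ) ⊗ₖ X) = qfi ρ X := by
  obtain ⟨L, hL⟩ := exists_isSLD hρ hX
  have h : IsSLD (σ ⊗ₖ ρ) ((1 : Matrix m m ℂ) ⊗ₖ X) ((1 : Matrix m m ℂ) ⊗ₖ L) := by
    refine ⟨?_, ?_⟩
    · rw [Matrix.IsHermitian, Matrix.conjTranspose_kronecker, hL.isHermitian.eq,
        Matrix.conjTranspose_one]
    · simp only [← Matrix.mul_kronecker_mul, Matrix.mul_one, Matrix.one_mul]
      rw [← Matrix.kronecker_add, ← Matrix.kronecker_smul, ← hL.eq, Matrix.kronecker_smul]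
      congr 1
      ext i j
      simp [mul_sub]
  rw [qfi_eq h, qfi_eq hL, ← Matrix.mul_kronecker_mul, ← Matrix.mul_kronecker_mul,
    Matrix.trace_kronecker, Matrix.mul_one, Matrix.mul_one, hσ.trace_eq_one, one_mul]

end Fisher

/-! ### Channels, their duals and partial traces -/

section Channel

variable {m n : Type*} [Fintype m] [Fintype n]

theorem trace_kronecker_one_mul [DecidableEq n] (ω : Matrix m m ℂ)
    (M : Matrix (m × n) (m × n) ℂ) :
    ((ω ⊗ₖ (1 : Matrix n n ℂ)) * M).trace = (ω * partialTraceRight M).trace := by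
  simp only [Matrix.trace, Matrix.diag, Matrix.mul_apply, partialTraceRight, Matrix.of_apply,
    Fintype.sum_prod_type, Matrix.kronecker_apply, Matrix.one_apply, mul_ite, mul_one, mul_zero,
    ite_mul, zero_mul, Finset.sum_ite_eq, Finset.mem_univ, if_true, Finset.mul_sum]
  refine Finset.sum_congr rfl fun i _ => ?_
  rw [Finset.sum_comm]

/-- Represents the average of `M` over `ρ` in the second factor by an operator on the first. It is
what turns the squared error on `A ⊗ B` into an operator on `A`. -/
theorem trace_kronecker_mul [DecidableEq m] [DecidableEq n] (ω : Matrix m m ℂ) (ρ : Matrix n n ℂ)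
    (M : Matrix (m × n) (m × n) ℂ) :
    ((ω ⊗ₖ ρ) * M).trace =
      (ω * partialTraceRight (((1 : Matrix m m ℂ) ⊗ₖ ρ) * M)).trace := by
  rw [← trace_kronecker_one_mul, ← Matrix.mul_assoc, ← Matrix.mul_kronecker_mul, Matrix.mul_one,
    Matrix.one_mul]

theorem IsChannel.posSemidef {Φ : Matrix m m ℂ →ₗ[ℂ] Matrix n n ℂ} (hΦ : IsChannel Φ)
    {M : Matrix m m ℂ} (hM : M.PosSemidef) : (Φ M).PosSemidef :=
  (hΦ.completelyPositive 1 (M.submatrix Prod.fst Prod.fst) (hM.submatrix _)).submatrix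
    (fun i => (i, 0))

theorem IsChannel.isState {Φ : Matrix m m ℂ →ₗ[ℂ] Matrix n n ℂ} (hΦ : IsChannel Φ)
    {ρ : Matrix m m ℂ} (hρ : IsState ρ) : IsState (Φ ρ) :=
  ⟨hΦ.posSemidef hρ.posSemidef, by rw [hΦ.tracePreserving, hρ.trace_eq_one]⟩

/-- The order on `ℂ` makes the quadratic form real, and over `ℂ` a real quadratic form already
forces Hermiticity. -/
theorem posSemidef_of_dotProduct_mulVec [DecidableEq n] {M : Matrix n n ℂ}
    (h : ∀ x : n → ℂ, 0 ≤ star x ⬝ᵥ (M *ᵥ x)) : M.PosSemidef := by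
  rw [← Matrix.isPositive_toEuclideanLin_iff, LinearMap.isPositive_iff_complex]
  intro x
  have hx := Complex.nonneg_iff.1 (h x)
  have : inner ℂ (M.toEuclideanLin x) x = star (star x.ofLp ⬝ᵥ (M *ᵥ x.ofLp)) := by
    rw [EuclideanSpace.inner_eq_star_dotProduct, Matrix.star_dotProduct, star_star,
      dotProduct_comm]
    rfl
  rw [this]
  refine ⟨Complex.ext ?_ ?_, ?_⟩
  · simp
  · simp [← hx.2]
  · simpa using hx.1

theorem IsChannel.posSemidef_dualMap [DecidableEq m] [DecidableEq n]
    {Φ : Matrix m m ℂ →ₗ[ℂ] Matrix n n ℂ} (hΦ : IsChannel Φ)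
    {W : Matrix n n ℂ} (hW : W.PosSemidef) : (dualMap Φ W).PosSemidef := by
  refine posSemidef_of_dotProduct_mulVec fun x => ?_
  have hx := hΦ.posSemidef (Matrix.posSemidef_vecMulVec_self_star x)
  rw [← trace_vecMulVec_mul, Matrix.trace_mul_comm, trace_dualMap_mul]
  exact Complex.nonneg_iff.2 ⟨re_trace_mul_nonneg hW hx, (im_trace_mul_eq_zero hW.1 hx.1).symm⟩

/-- Trace preservation makes the dual unital. With positivity of the dual, effects are pulled back
to effects. -/
theorem IsChannel.one_sub_dualMap [DecidableEq m] [DecidableEq n]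
    {Φ : Matrix m m ℂ →ₗ[ℂ] Matrix n n ℂ} (hΦ : IsChannel Φ) (W : Matrix n n ℂ) :
    1 - dualMap Φ W = dualMap Φ (1 - W) := by
  ext i j
  simp only [Matrix.sub_apply, dualMap, Matrix.of_apply, Matrix.sub_mul, Matrix.one_mul,
    Matrix.trace_sub, hΦ.tracePreserving]
  congr 1
  rcases eq_or_ne i j with rfl | h
  · simp
  · rw [Matrix.one_apply_ne h, Matrix.trace_single_eq_of_ne _ _ _ h.symm]

/-- The channel which discards its input and prepares the state `ρ`. -/
theorem exists_isChannel {ρ : Matrix n n ℂ} (hρ : IsState ρ) :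
    ∃ Φ : Matrix m m ℂ →ₗ[ℂ] Matrix n n ℂ, IsChannel Φ := by
  classical
  refine ⟨(Matrix.traceLinearMap m ℂ ℂ).smulRight ρ, fun r M hM => ?_, fun M => ?_⟩
  · have h : ampliation ((Matrix.traceLinearMap m ℂ ℂ).smulRight ρ) M =
        ρ ⊗ₖ (∑ x, M.submatrix (fun i => (x, i)) (fun i => (x, i))) := by
      ext i j
      simp [ampliation, Matrix.trace, Matrix.sum_apply, mul_comm]
    rw [h]
    exact hρ.posSemidef.kronecker (Matrix.posSemidef_sum _ fun x _ => hM.submatrix _)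
  · simp [hρ.trace_eq_one]

end Channel

/-! ### Matrix elements from superpositions of eigenvectors -/

section Superposition

variable {n : Type*} [Fintype n]

theorem dotProduct_mulVec_symm {Y : Matrix n n ℂ} (hY : Y.IsHermitian) (u v : n → ℂ) :
    star v ⬝ᵥ (Y *ᵥ u) = star (star u ⬝ᵥ (Y *ᵥ v)) := by
  rw [Matrix.star_dotProduct v, Matrix.star_mulVec, hY.eq, Matrix.dotProduct_mulVec]

/-- Supplies the relative phase of a superposition: once `c z` is purely imaginary, `star (c z) - c
z` has the largest possible modulus `2‖z‖`. -/
theorem exists_unit_mul_eq_I (z : ℂ) : ∃ c : ℂ, star c * c = 1 ∧ c * z = Complex.I * ‖z‖ := by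
  rcases eq_or_ne z 0 with rfl | hz
  · exact ⟨1, by simp⟩
  · have hn : (‖z‖ : ℂ) ≠ 0 := by simpa using hz
    have hzz : star z * z = (‖z‖ : ℂ) ^ 2 := by
      rw [mul_comm, Complex.star_def, Complex.mul_conj, Complex.normSq_eq_norm_sq]
      push_cast
      ring
    refine ⟨Complex.I * star z / ‖z‖, ?_, ?_⟩
    · have : star (Complex.I * star z / ‖z‖) = -Complex.I * z / ‖z‖ := by
        simp
      rw [this, div_mul_div_comm, mul_mul_mul_comm, mul_comm z, hzz]
      simp [Complex.I_mul_I]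
      field_simp
    · rw [div_mul_eq_mul_div, mul_assoc, hzz]
      field_simp

/-- A bound on the commutator expectation over states supported in `S` bounds the matrix elements
of `Y` between eigenvectors of `M` for the eigenvalues `1` and `0`. -/
theorem norm_matrixElement_sq_le {Y M Q : Matrix n n ℂ} {S : Submodule ℂ (n → ℂ)} {Γ : ℝ}
    (hY : Y.IsHermitian) (hM : M.IsHermitian)
    (H : ∀ σ : Matrix n n ℂ, IsState σ → LinearMap.range σ.mulVecLin ≤ S →
      ‖(σ * (Y * M - M * Y)).trace‖ ^ 2 ≤ Γ ^ 2 * (σ * Q).trace.re)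
    {u v : n → ℂ} (hu : star u ⬝ᵥ u = 1) (hv : star v ⬝ᵥ v = 1) (huv : star u ⬝ᵥ v = 0)
    (huS : u ∈ S) (hvS : v ∈ S) (hMu : M *ᵥ u = u) (hMv : M *ᵥ v = 0) :
    ‖star u ⬝ᵥ (Y *ᵥ v)‖ ^ 2 ≤ Γ ^ 2 * (((Matrix.vecMulVec u (star u) * Q).trace.re +
      (Matrix.vecMulVec v (star v) * Q).trace.re) / 2) := by
  set z := star u ⬝ᵥ (Y *ᵥ v) with hz
  have hvu : star v ⬝ᵥ u = 0 := by
    rw [Matrix.star_dotProduct, huv, star_zero]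
  have hz' : star v ⬝ᵥ (Y *ᵥ u) = star z := dotProduct_mulVec_symm hY u v
  obtain ⟨c₀, hc₀, hcz⟩ := exists_unit_mul_eq_I z
  -- The test state is the normalised projector on `u + c v`; its commutator expectation is `(star
  -- (c z) - c z) / 2`, of modulus `‖z‖`.
  have key : ∀ c : ℂ, star c * c = 1 → (c = c₀ ∨ c = -c₀) →
      ‖z‖ ^ 2 ≤ Γ ^ 2 * ((Matrix.vecMulVec (u + c • v) (star (u + c • v)) * Q).trace.re / 2) := by
    intro c hc hcc
    set w := u + c • v with hw
    have hww : star w ⬝ᵥ w = 2 := by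
      simp only [hw, star_add, star_smul, add_dotProduct, dotProduct_add, smul_dotProduct,
        dotProduct_smul, hu, hv, huv, hvu, smul_eq_mul]
      linear_combination hc
    have hs : IsState ((1 / 2 : ℂ) • Matrix.vecMulVec w (star w)) := by
      refine ⟨(Matrix.posSemidef_vecMulVec_self_star w).smul ?_, ?_⟩
      · exact Complex.nonneg_iff.2 (by norm_num)
      · rw [Matrix.trace_smul, Matrix.trace_vecMulVec, dotProduct_comm, hww]
        norm_num
    have hr : LinearMap.range ((1 / 2 : ℂ) • Matrix.vecMulVec w (star w)).mulVecLin ≤ S := by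
      rintro _ ⟨x, rfl⟩
      have : ((1 / 2 : ℂ) • Matrix.vecMulVec w (star w)).mulVecLin x =
          (1 / 2 * (star w ⬝ᵥ x) : ℂ) • w := by
        rw [Matrix.mulVecLin_apply, Matrix.smul_mulVec, Matrix.vecMulVec_mulVec, mul_smul]
        simp
      rw [this]
      exact S.smul_mem _ (S.add_mem huS (S.smul_mem _ hvS))
    have h := H _ hs hr
    have h1 : star w ⬝ᵥ ((Y * M - M * Y) *ᵥ w) = star c * star z - c * z := by
      rw [Matrix.sub_mulVec, dotProduct_sub, ← Matrix.mulVec_mulVec, ← Matrix.mulVec_mulVec,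
        Matrix.dotProduct_mulVec _ M]
      have hMw : M *ᵥ w = u := by
        rw [hw, Matrix.mulVec_add, Matrix.mulVec_smul, hMu, hMv, smul_zero, add_zero]
      have hwM : star w ᵥ* M = star u := by
        rw [← hM.eq, ← Matrix.star_mulVec, hMw]
      rw [hMw, hwM, hw, star_add, add_dotProduct, star_smul, smul_dotProduct, hz',
        Matrix.mulVec_add, Matrix.mulVec_smul, dotProduct_add, dotProduct_smul, ← hz]
      simp only [smul_eq_mul]
      ring
    have h2 : ‖star c * star z - c * z‖ = 2 * ‖z‖ := by
      have h3 : star c * star z = star (c * z) := by rw [star_mul', mul_comm]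
      have h4 : ‖Complex.I * (‖z‖ : ℂ)‖ = ‖z‖ := by simp
      rcases hcc with rfl | rfl
      · rw [h3, hcz]
        have : star (Complex.I * (‖z‖ : ℂ)) - Complex.I * ‖z‖ = -(2 * (Complex.I * ‖z‖)) := by
          simp
          ring
        rw [this, norm_neg, norm_mul, h4]
        norm_num
      · rw [h3, neg_mul, hcz]
        have : star (-(Complex.I * (‖z‖ : ℂ))) - -(Complex.I * ‖z‖) = 2 * (Complex.I * ‖z‖) := by
          simp
          ring
        rw [this, norm_mul, h4]
        norm_num
    rw [Matrix.smul_mul, Matrix.trace_smul, trace_vecMulVec_mul, h1, Matrix.smul_mul,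
      Matrix.trace_smul, smul_eq_mul, smul_eq_mul, norm_mul, h2] at h
    have h5 : ‖(1 / 2 : ℂ)‖ = 1 / 2 := by norm_num
    have h6 : ∀ t : ℂ, ((1 / 2 : ℂ) * t).re = t.re / 2 := fun t => by
      have : (1 / 2 : ℂ) = ((1 / 2 : ℝ) : ℂ) := by norm_num
      rw [this, Complex.re_ofReal_mul]
      ring
    rw [h5, h6] at h
    calc ‖z‖ ^ 2 = (1 / 2 * (2 * ‖z‖)) ^ 2 := by ring
      _ ≤ _ := h
  have h1 := key c₀ hc₀ (Or.inl rfl)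
  have h2 := key (-c₀) (by rw [star_neg, neg_mul_neg, hc₀]) (Or.inr rfl)
  -- Averaging over the signs `±c₀` cancels the cross terms, leaving only the diagonal elements of
  -- `Q`.
  have h3 : Matrix.vecMulVec (u + c₀ • v) (star (u + c₀ • v)) +
      Matrix.vecMulVec (u + -c₀ • v) (star (u + -c₀ • v)) =
      (2 : ℂ) • (Matrix.vecMulVec u (star u) + Matrix.vecMulVec v (star v)) := by
    ext i j
    simp only [Matrix.add_apply, Matrix.vecMulVec_apply, Matrix.smul_apply, Pi.add_apply,
      Pi.smul_apply, Pi.star_apply, star_add, star_smul, smul_eq_mul, star_neg]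
    linear_combination (2 * v i * star (v j)) * hc₀
  have h4 := congrArg (fun N => (N * Q).trace.re) h3
  simp only [Matrix.add_mul, Matrix.trace_add, Complex.add_re, Matrix.smul_mul, Matrix.trace_smul,
    smul_eq_mul, Complex.mul_re, Complex.re_ofNat, Complex.im_ofNat, zero_mul, sub_zero] at h4
  have h5 : Γ ^ 2 * (((Matrix.vecMulVec u (star u) * Q).trace.re +
      (Matrix.vecMulVec v (star v) * Q).trace.re) / 2) =
      (Γ ^ 2 * ((Matrix.vecMulVec (u + c₀ • v) (star (u + c₀ • v)) * Q).trace.re / 2) +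
      Γ ^ 2 * ((Matrix.vecMulVec (u + -c₀ • v) (star (u + -c₀ • v)) * Q).trace.re / 2)) / 2 := by
    linear_combination (-(Γ ^ 2) / 4) * h4
  rw [h5]
  linarith

/-- Bounds on matrix elements of `Y` between eigenvectors of `P` and of `N` sum up to a bound on
`Tr (P Y N Y)`. -/
theorem re_trace_mul_mul_mul_le [DecidableEq n] {P N Y Q : Matrix n n ℂ} {c : ℝ}
    (hP : P.PosSemidef) (hN : N.PosSemidef) (hY : Y.IsHermitian)
    (H : ∀ (u v : n → ℂ) (l m : ℝ), 0 < l → 0 < m → star u ⬝ᵥ u = 1 → star v ⬝ᵥ v = 1 →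
      P *ᵥ u = (l : ℂ) • u → N *ᵥ v = (m : ℂ) • v →
      ‖star u ⬝ᵥ (Y *ᵥ v)‖ ^ 2 ≤ c * (((Matrix.vecMulVec u (star u) * Q).trace.re +
        (Matrix.vecMulVec v (star v) * Q).trace.re) / 2)) :
    (P * Y * N * Y).trace.re ≤
      c * ((N.trace.re * (P * Q).trace.re + P.trace.re * (N * Q).trace.re) / 2) := by
  obtain ⟨l, u, hl, hu, hPu, hPd⟩ := exists_spectral_decomposition hP
  obtain ⟨m, v, hm, hv, hNv, hNd⟩ := exists_spectral_decomposition hN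
  set f : n → ℝ := fun i => (Matrix.vecMulVec (u i) (star (u i)) * Q).trace.re with hf
  set g : n → ℝ := fun i => (Matrix.vecMulVec (v i) (star (v i)) * Q).trace.re with hg
  have e1 : (P * Y * N * Y).trace.re =
      ∑ i, ∑ j, l i * m j * ‖star (u i) ⬝ᵥ (Y *ᵥ v j)‖ ^ 2 := by
    have hterm : ∀ i j, (Matrix.vecMulVec (u i) (star (u i)) * Y *
        Matrix.vecMulVec (v j) (star (v j)) * Y).trace.re =
        ‖star (u i) ⬝ᵥ (Y *ᵥ v j)‖ ^ 2 := by
      intro i j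
      have hz' : star (v j) ⬝ᵥ (Y *ᵥ u i) = star (star (u i) ⬝ᵥ (Y *ᵥ v j)) :=
        dotProduct_mulVec_symm hY _ _
      rw [Matrix.vecMulVec_mul, Matrix.vecMulVec_mul_vecMulVec, trace_vecMulVec_mul,
        smul_dotProduct, hz', ← Matrix.dotProduct_mulVec, smul_eq_mul, Complex.star_def,
        Complex.mul_conj, Complex.ofReal_re, Complex.normSq_eq_norm_sq]
    have : (P * Y * N * Y).trace = ∑ i, ∑ j, ((l i * m j : ℝ) : ℂ) *
        (Matrix.vecMulVec (u i) (star (u i)) * Y *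
          Matrix.vecMulVec (v j) (star (v j)) * Y).trace := by
      conv_lhs => rw [hPd, hNd]
      simp only [Matrix.sum_mul, Matrix.mul_sum, Matrix.trace_sum, Matrix.smul_mul, Matrix.mul_smul,
        Matrix.trace_smul, smul_eq_mul]
      rw [Finset.sum_comm]
      refine Finset.sum_congr rfl fun i _ => ?_
      rw [Finset.mul_sum]
      refine Finset.sum_congr rfl fun j _ => ?_
      push_cast
      ring
    rw [this]
    simp only [Complex.re_sum, Complex.re_ofReal_mul, hterm]
  have tr1 : ∀ {w : n → ℂ}, star w ⬝ᵥ w = 1 → (Matrix.vecMulVec w (star w)).trace = 1 :=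
    fun {w} hw => by rw [Matrix.trace_vecMulVec, dotProduct_comm, hw]
  have e2 : P.trace.re = ∑ i, l i := by
    conv_lhs => rw [hPd]
    simp [Matrix.trace_sum, Matrix.trace_smul, tr1 (hu _)]
  have e3 : N.trace.re = ∑ i, m i := by
    conv_lhs => rw [hNd]
    simp [Matrix.trace_sum, Matrix.trace_smul, tr1 (hv _)]
  have e4 : (P * Q).trace.re = ∑ i, l i * f i := by
    conv_lhs => rw [hPd]
    simp only [Matrix.sum_mul, Matrix.trace_sum, Complex.re_sum, Matrix.smul_mul,
      Matrix.trace_smul, smul_eq_mul, Complex.re_ofReal_mul, hf]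
  have e5 : (N * Q).trace.re = ∑ i, m i * g i := by
    conv_lhs => rw [hNd]
    simp only [Matrix.sum_mul, Matrix.trace_sum, Complex.re_sum, Matrix.smul_mul,
      Matrix.trace_smul, smul_eq_mul, Complex.re_ofReal_mul, hg]
  have e6 : c * ((N.trace.re * (P * Q).trace.re + P.trace.re * (N * Q).trace.re) / 2) =
      ∑ i, ∑ j, l i * m j * (c * ((f i + g j) / 2)) := by
    rw [e2, e3, e4, e5, mul_comm (∑ i, m i), Finset.sum_mul_sum, Finset.sum_mul_sum,
      ← Finset.sum_add_distrib, Finset.sum_div, Finset.mul_sum]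
    refine Finset.sum_congr rfl fun i _ => ?_
    rw [← Finset.sum_add_distrib, Finset.sum_div, Finset.mul_sum]
    exact Finset.sum_congr rfl fun j _ => by ring
  rw [e1, e6]
  refine Finset.sum_le_sum fun i _ => Finset.sum_le_sum fun j _ => ?_
  rcases (hl i).eq_or_lt with h | h
  · simp [← h]
  rcases (hm j).eq_or_lt with h' | h'
  · simp [← h']
  exact mul_le_mul_of_nonneg_left
    (H (u i) (v j) (l i) (m j) h h' (hu i) (hv j) (hPu i) (hNv j)) (mul_pos h h').le

end Superposition

/-! ### Uncertainty relation under the conservation law and the pair bound -/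

section Uncertainty

variable {a b : Type*} [Fintype a] [Fintype b]

/-- The trace pairing is nondegenerate, so a marginal of a Hermitian operator against a Hermitian
`ρB` inherits Hermiticity. -/
theorem isHermitian_of_trace_kronecker_mul {Z : Matrix (a × b) (a × b) ℂ} {ρB : Matrix b b ℂ}
    {Y : Matrix a a ℂ} (hρB : ρB.IsHermitian) (hZ : Z.IsHermitian)
    (hmarg : ∀ ω : Matrix a a ℂ, ((ω ⊗ₖ ρB) * Z).trace = (ω * Y).trace) : Y.IsHermitian := by
  refine Matrix.ext_iff_trace_mul_left.2 fun ω => ?_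
  have h := hmarg ωᴴ
  have h1 : ((ωᴴ ⊗ₖ ρB) * Z).trace = star ((ω ⊗ₖ ρB) * Z).trace := by
    rw [← Matrix.trace_conjTranspose, Matrix.conjTranspose_mul, Matrix.conjTranspose_kronecker,
      hρB.eq, hZ.eq, Matrix.trace_mul_comm]
  rw [h1, hmarg, ← Matrix.trace_conjTranspose, Matrix.conjTranspose_mul,
    Matrix.trace_mul_comm] at h
  have h2 := congrArg star h
  rwa [← Matrix.trace_conjTranspose, ← Matrix.trace_conjTranspose, Matrix.conjTranspose_mul,
    Matrix.conjTranspose_mul, Matrix.conjTranspose_conjTranspose,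
    Matrix.conjTranspose_conjTranspose, Matrix.trace_mul_comm, Matrix.trace_mul_comm Yᴴ,
    eq_comm] at h2

variable [DecidableEq a] [DecidableEq b]

/-- If `G` commutes with `Z + 1 ⊗ X_B`, then it approximates `M ⊗ 1` only up to an error controlled
by the quantum Fisher informations of `Z` and `X_B`. -/
theorem norm_trace_comm_le_of_commute {σ Y M : Matrix a a ℂ} {ρB XB : Matrix b b ℂ}
    {Z G : Matrix (a × b) (a × b) ℂ} (hσ : IsState σ) (hρB : IsState ρB) (hZ : Z.IsHermitian)
    (hXB : XB.IsHermitian) (hG : G.IsHermitian) (hM : M.IsHermitian)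
    (hmarg : ∀ ω : Matrix a a ℂ, ((ω ⊗ₖ ρB) * Z).trace = (ω * Y).trace)
    (hcomm : (Z + (1 : Matrix a a ℂ) ⊗ₖ XB) * G = G * (Z + (1 : Matrix a a ℂ) ⊗ₖ XB)) :
    ‖(σ * (Y * M - M * Y)).trace‖ ≤ (√(qfi (σ ⊗ₖ ρB) Z) + √(qfi ρB XB)) *
      √((σ ⊗ₖ ρB) * ((G - M ⊗ₖ (1 : Matrix b b ℂ)) *
        (G - M ⊗ₖ (1 : Matrix b b ℂ)))).trace.re := by
  set η := σ ⊗ₖ ρB with hη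
  set M₁ := M ⊗ₖ (1 : Matrix b b ℂ) with hM₁
  set X₁ := (1 : Matrix a a ℂ) ⊗ₖ XB with hX₁
  have hηs : IsState η := isState_kronecker hσ hρB
  have hM₁h : M₁.IsHermitian := by
    rw [Matrix.IsHermitian, hM₁, Matrix.conjTranspose_kronecker, hM.eq, Matrix.conjTranspose_one]
  have hX₁h : X₁.IsHermitian := by
    rw [Matrix.IsHermitian, hX₁, Matrix.conjTranspose_kronecker, hXB.eq, Matrix.conjTranspose_one]
  have hW : (G - M₁).IsHermitian := hG.sub hM₁h
  have h1 := norm_trace_comm_le hηs.posSemidef hZ hW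
  have h2 := norm_trace_comm_le hηs.posSemidef hX₁h hW
  rw [qfi_one_kronecker hσ hρB.posSemidef hXB] at h2
  have hXM : X₁ * M₁ = M₁ * X₁ := by
    simp only [hX₁, hM₁, ← Matrix.mul_kronecker_mul, Matrix.one_mul, Matrix.mul_one]
  have hZM : (η * (Z * M₁ - M₁ * Z)).trace = (σ * (Y * M - M * Y)).trace := by
    have e1 : (η * (Z * M₁)).trace = (σ * (Y * M)).trace := by
      rw [← Matrix.mul_assoc, Matrix.trace_mul_comm, ← Matrix.mul_assoc, hη, hM₁,
        ← Matrix.mul_kronecker_mul, Matrix.one_mul, hmarg, Matrix.mul_assoc, Matrix.trace_mul_comm,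
        Matrix.mul_assoc]
    have e2 : (η * (M₁ * Z)).trace = (σ * (M * Y)).trace := by
      rw [← Matrix.mul_assoc, hη, hM₁, ← Matrix.mul_kronecker_mul, Matrix.mul_one, hmarg,
        Matrix.mul_assoc]
    rw [Matrix.mul_sub, Matrix.trace_sub, e1, e2, ← Matrix.trace_sub, ← Matrix.mul_sub]
  -- `G` drops out by `hcomm`, and `X₁` commutes with `M₁`; only the commutator of `Z` with `M₁`
  -- survives.
  have hsum : Z * (G - M₁) - (G - M₁) * Z + (X₁ * (G - M₁) - (G - M₁) * X₁) =
      -(Z * M₁ - M₁ * Z) := by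
    have hc : Z * G + X₁ * G = G * Z + G * X₁ := by
      rw [← Matrix.add_mul, ← Matrix.mul_add, hcomm]
    have : Z * (G - M₁) - (G - M₁) * Z + (X₁ * (G - M₁) - (G - M₁) * X₁) =
        (Z * G + X₁ * G) - (G * Z + G * X₁) - (X₁ * M₁ - M₁ * X₁) - (Z * M₁ - M₁ * Z) := by
      simp only [Matrix.mul_sub, Matrix.sub_mul]
      abel
    rw [this, hc, hXM]
    simp
  have h3 : ‖(σ * (Y * M - M * Y)).trace‖ =
      ‖(η * (Z * (G - M₁) - (G - M₁) * Z)).trace +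
        (η * (X₁ * (G - M₁) - (G - M₁) * X₁)).trace‖ := by
    rw [← Matrix.trace_add, ← Matrix.mul_add, hsum, Matrix.mul_neg, Matrix.trace_neg, norm_neg, hZM]
  rw [h3, add_mul]
  exact (norm_add_le _ _).trans (add_le_add h1 h2)

/-- The mean squared error with which an effect `G` distinguishes `P` and `N` is at most its error
probability. -/
theorem noise_add_noise_le {P N M : Matrix a a ℂ} {ρB : Matrix b b ℂ}
    {G : Matrix (a × b) (a × b) ℂ} (hP : P.PosSemidef) (hN : N.PosSemidef) (hρB : IsState ρB)
    (hG : G.PosSemidef) (hG1 : (1 - G).PosSemidef) (hMP : M * P = P) (hPM : P * M = P)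
    (hMN : M * N = 0) (hNM : N * M = 0) :
    ((P ⊗ₖ ρB) * ((G - M ⊗ₖ (1 : Matrix b b ℂ)) * (G - M ⊗ₖ (1 : Matrix b b ℂ)))).trace.re +
      ((N ⊗ₖ ρB) * ((G - M ⊗ₖ (1 : Matrix b b ℂ)) * (G - M ⊗ₖ (1 : Matrix b b ℂ)))).trace.re ≤
      P.trace.re - ((P ⊗ₖ ρB) * G).trace.re + ((N ⊗ₖ ρB) * G).trace.re := by
  set M₁ := M ⊗ₖ (1 : Matrix b b ℂ) with hM₁
  have hP' : (P ⊗ₖ ρB).PosSemidef := hP.kronecker hρB.posSemidef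
  have hN' : (N ⊗ₖ ρB).PosSemidef := hN.kronecker hρB.posSemidef
  have e1 : M₁ * (P ⊗ₖ ρB) = P ⊗ₖ ρB := by rw [hM₁, ← Matrix.mul_kronecker_mul, hMP, Matrix.one_mul]
  have e2 : (P ⊗ₖ ρB) * M₁ = P ⊗ₖ ρB := by rw [hM₁, ← Matrix.mul_kronecker_mul, hPM, Matrix.mul_one]
  have e3 : M₁ * (N ⊗ₖ ρB) = 0 := by
    rw [hM₁, ← Matrix.mul_kronecker_mul, hMN, Matrix.zero_kronecker]
  have e4 : (N ⊗ₖ ρB) * M₁ = 0 := by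
    rw [hM₁, ← Matrix.mul_kronecker_mul, hNM, Matrix.zero_kronecker]
  -- `G - G² = G(1 - G)G + (1 - G)G(1 - G)`.
  have hGG : (G - G * G).PosSemidef := by
    have h1 := hG1.conjTranspose_mul_mul_same G
    have h2 := hG.conjTranspose_mul_mul_same (1 - G)
    rw [hG.1.eq] at h1
    rw [hG1.1.eq] at h2
    convert h1.add h2 using 1
    simp only [Matrix.mul_sub, Matrix.sub_mul, Matrix.mul_one, Matrix.one_mul]
    abel
  have expand : ∀ A : Matrix (a × b) (a × b) ℂ, (A * ((G - M₁) * (G - M₁))).trace =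
      (A * (G * G)).trace - (M₁ * A * G).trace - (A * M₁ * G).trace + (A * M₁ * M₁).trace := by
    intro A
    have h1 : (M₁ * A * G).trace = (A * (G * M₁)).trace := by
      rw [Matrix.mul_assoc, Matrix.trace_mul_comm, Matrix.mul_assoc]
    rw [h1]
    simp only [Matrix.mul_sub, Matrix.sub_mul, Matrix.trace_sub, Matrix.mul_assoc]
    ring
  rw [expand, expand, e1, e2, e2, e3, e4]
  have htr : (P ⊗ₖ ρB).trace = P.trace := by
    rw [Matrix.trace_kronecker, hρB.trace_eq_one, mul_one]
  have h1 := re_trace_mul_le_of_le hP' hGG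
  have h2 := re_trace_mul_le_of_le hN' hGG
  rw [htr]
  simp only [Matrix.zero_mul, Matrix.trace_zero, Complex.add_re, Complex.sub_re, Complex.zero_re]
  linarith

/-- The bound for a pair of test states. -/
theorem re_trace_posPart_negPart_le {Y M ρ₁ ρ₂ : Matrix a a ℂ} {ρB XB : Matrix b b ℂ}
    {Z G : Matrix (a × b) (a × b) ℂ} {S : Submodule ℂ (a → ℂ)} {Δ : ℝ} (h₁ : IsState ρ₁)
    (h₂ : IsState ρ₂) (hS₁ : LinearMap.range ρ₁.mulVecLin ≤ S)
    (hS₂ : LinearMap.range ρ₂.mulVecLin ≤ S) (hρB : IsState ρB) (hZ : Z.IsHermitian)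
    (hXB : XB.IsHermitian) (hG : G.PosSemidef) (hG1 : (1 - G).PosSemidef) (hM : M.IsHermitian)
    (hΔ : ∀ σ : Matrix a a ℂ, IsState σ → LinearMap.range σ.mulVecLin ≤ S →
      √(qfi (σ ⊗ₖ ρB) Z) ≤ Δ)
    (hmarg : ∀ ω : Matrix a a ℂ, ((ω ⊗ₖ ρB) * Z).trace = (ω * Y).trace)
    (hcomm : (Z + (1 : Matrix a a ℂ) ⊗ₖ XB) * G = G * (Z + (1 : Matrix a a ℂ) ⊗ₖ XB))
    (hMP : M * (ρ₁ - ρ₂)⁺ = (ρ₁ - ρ₂)⁺) (hPM : (ρ₁ - ρ₂)⁺ * M = (ρ₁ - ρ₂)⁺)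
    (hMN : M * (ρ₁ - ρ₂)⁻ = 0) (hNM : (ρ₁ - ρ₂)⁻ * M = 0) :
    ((ρ₁ - ρ₂)⁺ * Y * (ρ₁ - ρ₂)⁻ * Y).trace.re ≤ (Δ + √(qfi ρB XB)) ^ 2 *
      (traceDist ρ₁ ρ₂ * (((ρ₁ - ρ₂) * M).trace.re - (((ρ₁ - ρ₂) ⊗ₖ ρB) * G).trace.re) / 2) := by
  have hD := isHermitian_state_sub h₁ h₂
  have hPN := CFC.posPart_sub_negPart (ρ₁ - ρ₂) hD
  obtain ⟨hTP, hTN⟩ := re_trace_posPart hD (trace_state_sub h₁ h₂)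
  have hP := posSemidef_posPart (ρ₁ - ρ₂)
  have hN := posSemidef_negPart (ρ₁ - ρ₂)
  have hDS : ∀ x, (ρ₁ - ρ₂) *ᵥ x ∈ S := fun x => by
    rw [Matrix.sub_mulVec]
    exact S.sub_mem (hS₁ ⟨x, rfl⟩) (hS₂ ⟨x, rfl⟩)
  set P := (ρ₁ - ρ₂)⁺
  set N := (ρ₁ - ρ₂)⁻
  set W := G - M ⊗ₖ (1 : Matrix b b ℂ) with hW
  have hWh : W.IsHermitian := by
    refine hG.1.sub ?_
    rw [Matrix.IsHermitian, Matrix.conjTranspose_kronecker, hM.eq, Matrix.conjTranspose_one]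
  have hWW : (W * W).PosSemidef := by
    have := Matrix.posSemidef_conjTranspose_mul_self W
    rwa [hWh.eq] at this
  set Q := partialTraceRight (((1 : Matrix a a ℂ) ⊗ₖ ρB) * (W * W))
  have hQ : ∀ ω : Matrix a a ℂ, (ω * Q).trace.re = ((ω ⊗ₖ ρB) * (W * W)).trace.re := fun ω => by
    rw [trace_kronecker_mul]
  have hY := isHermitian_of_trace_kronecker_mul hρB.posSemidef.1 hZ hmarg
  set Γ := Δ + √(qfi ρB XB) with hΓ
  have H : ∀ σ : Matrix a a ℂ, IsState σ → LinearMap.range σ.mulVecLin ≤ S →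
      ‖(σ * (Y * M - M * Y)).trace‖ ^ 2 ≤ Γ ^ 2 * (σ * Q).trace.re := by
    intro σ hσ hσS
    have h := norm_trace_comm_le_of_commute hσ hρB hZ hXB hG.1 hM hmarg hcomm
    rw [← hW] at h
    have h0 := re_trace_mul_nonneg (isState_kronecker hσ hρB).posSemidef hWW
    have h' := h.trans (mul_le_mul_of_nonneg_right (add_le_add_left (hΔ σ hσ hσS) _)
      (Real.sqrt_nonneg _))
    rw [← hΓ] at h'
    have h2 := pow_le_pow_left₀ (norm_nonneg _) h' 2
    rwa [mul_pow, Real.sq_sqrt h0, ← hQ] at h2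
  have key := re_trace_mul_mul_mul_le (Y := Y) (Q := Q) (c := Γ ^ 2) hP hN hY ?_
  · have hnoise := noise_add_noise_le (M := M) hP hN hρB hG hG1 hMP hPM hMN hNM
    rw [← hW, ← hQ, ← hQ] at hnoise
    have e1 : ((ρ₁ - ρ₂) * M).trace.re = P.trace.re := by
      rw [← hPN, Matrix.sub_mul, hPM, hNM, sub_zero]
    have e2 : (((ρ₁ - ρ₂) ⊗ₖ ρB) * G).trace.re =
        ((P ⊗ₖ ρB) * G).trace.re - ((N ⊗ₖ ρB) * G).trace.re := by
      have : (P - N) ⊗ₖ ρB = P ⊗ₖ ρB - N ⊗ₖ ρB := by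
        ext i j
        simp [sub_mul]
      rw [← hPN, this, Matrix.sub_mul, Matrix.trace_sub, Complex.sub_re]
    rw [hTP, hTN] at key
    rw [e1, e2]
    have hT0 := traceDist_nonneg h₁ h₂
    change _ ≤ Γ ^ 2 * ((traceDist ρ₁ ρ₂ * _ + traceDist ρ₁ ρ₂ * _) / 2) at key
    refine key.trans (mul_le_mul_of_nonneg_left ?_ (sq_nonneg Γ))
    rw [← mul_add]
    have := mul_le_mul_of_nonneg_left hnoise hT0
    linarith
  · intro u v l m hl hm hu hv hPu hNv
    have hl' : (l : ℂ) ≠ 0 := Complex.ofReal_ne_zero.2 hl.ne'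
    have hm' : (m : ℂ) ≠ 0 := Complex.ofReal_ne_zero.2 hm.ne'
    have hu' : u = P *ᵥ ((l : ℂ)⁻¹ • u) := by
      rw [Matrix.mulVec_smul, hPu, smul_smul, inv_mul_cancel₀ hl', one_smul]
    have hv' : v = N *ᵥ ((m : ℂ)⁻¹ • v) := by
      rw [Matrix.mulVec_smul, hNv, smul_smul, inv_mul_cancel₀ hm', one_smul]
    have hMu : M *ᵥ u = u := by
      rw [hu', Matrix.mulVec_mulVec, hMP]
    have hMv : M *ᵥ v = 0 := by
      rw [hv', Matrix.mulVec_mulVec, hMN, Matrix.zero_mulVec]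
    have hNu : N *ᵥ u = 0 := by
      rw [← hMu, Matrix.mulVec_mulVec, hNM, Matrix.zero_mulVec]
    have hMv' : (1 - M) *ᵥ v = v := by rw [Matrix.sub_mulVec, hMv, Matrix.one_mulVec, sub_zero]
    have hPv : P *ᵥ v = 0 := by
      rw [← hMv', Matrix.mulVec_mulVec, Matrix.mul_sub, hPM, Matrix.mul_one, sub_self,
        Matrix.zero_mulVec]
    -- `N` kills `u`, so `u` is an eigenvector of `ρ₁ - ρ₂` with nonzero eigenvalue and lies in its
    -- range. The same holds for `v`, so their superpositions are admissible in `Δ`.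
    have huS : u ∈ S := by
      have h : u = (l : ℂ)⁻¹ • ((ρ₁ - ρ₂) *ᵥ u) := by
        rw [← hPN, Matrix.sub_mulVec, hNu, sub_zero, hPu, smul_smul, inv_mul_cancel₀ hl', one_smul]
      rw [h]
      exact S.smul_mem _ (hDS u)
    have hvS : v ∈ S := by
      have h : v = -(m : ℂ)⁻¹ • ((ρ₁ - ρ₂) *ᵥ v) := by
        rw [← hPN, Matrix.sub_mulVec, hPv, zero_sub, hNv, smul_neg, neg_smul, neg_neg, smul_smul,
          inv_mul_cancel₀ hm', one_smul]
      rw [h]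
      exact S.smul_mem _ (hDS v)
    have huv : star u ⬝ᵥ v = 0 := by
      rw [← hMu, Matrix.star_mulVec, hM.eq, ← Matrix.dotProduct_mulVec, hMv, dotProduct_zero]
    exact norm_matrixElement_sq_le hY hM H hu hv huv huS hvS hMu hMv

end Uncertainty

/-! ### Infima and averages over pairs of test states -/

section Averages

/-- A bound valid for every recovery channel passes to the infimum, so no minimiser is needed. -/
theorem le_mul_sInf {S : Set ℝ} (hS : S.Nonempty) {x c : ℝ} (hc : 0 ≤ c)
    (h : ∀ y ∈ S, x ≤ c * y) : x ≤ c * sInf S := by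
  rcases hc.eq_or_lt with rfl | hc
  · obtain ⟨y, hy⟩ := hS
    simpa using h y hy
  · rw [← div_le_iff₀' hc]
    exact le_csInf hS fun y hy => (div_le_iff₀' hc).2 (h y hy)

variable {K : Type*} [Fintype K]

/-- The diagonal terms are nonnegative and may be added; symmetry of `T` then replaces the mean of
`e k` and `e k'` by `e k`, and Cauchy–Schwarz with weights `p k * p k'` concludes. -/
theorem sum_offDiag_le_sqrt_mul_sqrt {p e : K → ℝ} {T : K → K → ℝ} (hp : ∀ k, 0 ≤ p k)
    (hp1 : ∑ k, p k = 1) (he : ∀ k, 0 ≤ e k) (hT : ∀ k k', 0 ≤ T k k')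
    (hTs : ∀ k k', T k k' = T k' k) :
    ∑ q ∈ (Finset.univ : Finset K).offDiag, p q.1 * p q.2 * (T q.1 q.2 * (e q.1 + e q.2) / 2) ≤
      √(∑ k, p k * e k ^ 2) * √(∑ k, ∑ k', p k * p k' * T k k' ^ 2) := by
  have h1 : ∑ q ∈ (Finset.univ : Finset K).offDiag,
      p q.1 * p q.2 * (T q.1 q.2 * (e q.1 + e q.2) / 2) ≤
      ∑ k, ∑ k', p k * p k' * (T k k' * (e k + e k') / 2) := by
    rw [← Fintype.sum_prod_type' (f := fun k k' => p k * p k' * (T k k' * (e k + e k') / 2))]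
    refine Finset.sum_le_sum_of_subset_of_nonneg (Finset.subset_univ _) fun q _ _ => ?_
    have := hp q.1; have := hp q.2; have := he q.1; have := he q.2; have := hT q.1 q.2
    positivity
  have h2 : ∑ k, ∑ k', p k * p k' * (T k k' * (e k + e k') / 2) =
      ∑ k, ∑ k', p k * p k' * (T k k' * e k) := by
    have h3 : ∑ k, ∑ k', p k * p k' * (T k k' * e k') =
        ∑ k, ∑ k', p k * p k' * (T k k' * e k) := by
      rw [Finset.sum_comm]
      refine Finset.sum_congr rfl fun k _ => Finset.sum_congr rfl fun k' _ => ?_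
      rw [hTs k' k]
      ring
    have h4 : ∑ k, ∑ k', p k * p k' * (T k k' * (e k + e k') / 2) =
        (∑ k, ∑ k', p k * p k' * (T k k' * e k) + ∑ k, ∑ k', p k * p k' * (T k k' * e k')) / 2 := by
      rw [← Finset.sum_add_distrib, Finset.sum_div]
      refine Finset.sum_congr rfl fun k _ => ?_
      rw [← Finset.sum_add_distrib, Finset.sum_div]
      exact Finset.sum_congr rfl fun k' _ => by ring
    rw [h4, h3]
    ring
  refine h1.trans (h2.le.trans ?_)
  have h5 : ∑ k, p k * e k ^ 2 = ∑ q : K × K, p q.1 * p q.2 * e q.1 ^ 2 := by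
    rw [Fintype.sum_prod_type]
    refine Finset.sum_congr rfl fun k _ => ?_
    have : ∀ k', p k * p k' * e k ^ 2 = p k * e k ^ 2 * p k' := fun k' => by ring
    simp only [this]
    rw [← Finset.mul_sum, hp1, mul_one]
  rw [h5, ← Fintype.sum_prod_type' (f := fun k k' => p k * p k' * T k k' ^ 2),
    ← Fintype.sum_prod_type' (f := fun k k' => p k * p k' * (T k k' * e k)),
    ← Real.sqrt_mul (Finset.sum_nonneg fun q _ => mul_nonneg (mul_nonneg (hp _) (hp _))
      (sq_nonneg _))]
  refine Real.le_sqrt_of_sq_le (Finset.sum_sq_le_sum_mul_sum_of_sq_le_mul _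
    (fun q _ => mul_nonneg (mul_nonneg (hp _) (hp _)) (sq_nonneg _))
    (fun q _ => mul_nonneg (mul_nonneg (hp _) (hp _)) (sq_nonneg _)) fun q _ => le_of_eq (by ring))

variable [DecidableEq K]

theorem sum_offDiag_eq (f : K × K → ℝ) :
    ∑ q ∈ (Finset.univ : Finset K).offDiag, f q = ∑ k, ∑ k', f (k, k') - ∑ k, f (k, k) := by
  have h := Finset.sum_union (Finset.disjoint_diag_offDiag (Finset.univ : Finset K)) (f := f)
  rw [Finset.diag_union_offDiag, Finset.univ_product_univ, Fintype.sum_prod_type,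
    Finset.sum_diag] at h
  linarith

/-- The full double sum is `∑ p e`, and the omitted diagonal `∑ p² e` is at least `c ∑ p e`. -/
theorem sum_offDiag_le_one_sub_mul {p e : K → ℝ} {c : ℝ} (hp : ∀ k, 0 ≤ p k)
    (hp1 : ∑ k, p k = 1) (he : ∀ k, 0 ≤ e k) (hc : ∀ k, c ≤ p k) :
    ∑ q ∈ (Finset.univ : Finset K).offDiag, p q.1 * p q.2 * ((e q.1 + e q.2) / 2) ≤
      (1 - c) * ∑ k, p k * e k := by
  have h1 : ∑ k, ∑ k', p k * p k' * ((e k + e k') / 2) = ∑ k, p k * e k := by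
    have h2 : ∀ k, ∑ k', p k * p k' * ((e k + e k') / 2) =
        p k * e k / 2 + p k * ((∑ k', p k' * e k') / 2) := by
      intro k
      have : ∀ k', p k * p k' * ((e k + e k') / 2) =
          p k * e k / 2 * p k' + p k * (p k' * e k' / 2) := fun k' => by ring
      simp only [this]
      rw [Finset.sum_add_distrib, ← Finset.mul_sum, hp1, mul_one, ← Finset.mul_sum, Finset.sum_div]
    simp only [h2]
    rw [Finset.sum_add_distrib, ← Finset.sum_mul, hp1, ← Finset.sum_div]
    ring
  rw [sum_offDiag_eq (fun q : K × K => p q.1 * p q.2 * ((e q.1 + e q.2) / 2)), h1,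
    Finset.mul_sum, ← Finset.sum_sub_distrib]
  refine Finset.sum_le_sum fun k _ => ?_
  have := mul_le_mul_of_nonneg_right (hc k) (mul_nonneg (hp k) (he k))
  have e1 : p k * p k * ((e k + e k) / 2) = p k * (p k * e k) := by ring
  rw [e1]
  linarith

end Averages

/-! ### From recovery channels to effects compatible with the conservation law -/

section Recovery

variable {a b a' b' K : Type*}

theorem isHermitian_fluctuation [DecidableEq b] [Fintype a'] [Fintype b'] [DecidableEq b']
    {XA : Matrix a a ℂ} {XA' : Matrix a' a' ℂ}
    (U : Matrix (a' × b') (a × b) ℂ) (hXA : XA.IsHermitian) (hXA' : XA'.IsHermitian) :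
    (XA ⊗ₖ (1 : Matrix b b ℂ) - Uᴴ * (XA' ⊗ₖ (1 : Matrix b' b' ℂ)) * U).IsHermitian := by
  simp only [Matrix.IsHermitian, Matrix.conjTranspose_sub, Matrix.conjTranspose_mul,
    Matrix.conjTranspose_kronecker, Matrix.conjTranspose_conjTranspose, Matrix.conjTranspose_one,
    hXA.eq, hXA'.eq, Matrix.mul_assoc]

variable [Fintype a'] [Fintype b']

/-- The Heisenberg picture of the channel `ω ↦ Tr_{B'} [U (ω ⊗ ρ_B) U†]`. -/
theorem trace_kronecker_mul_heisenberg [Fintype a] [Fintype b] [DecidableEq b']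
    {U : Matrix (a' × b') (a × b) ℂ} {ρB : Matrix b b ℂ}
    {E : Matrix a a ℂ →ₗ[ℂ] Matrix a' a' ℂ}
    (hEU : ∀ ω : Matrix a a ℂ, E ω = partialTraceRight (U * (ω ⊗ₖ ρB) * Uᴴ))
    (W : Matrix a' a' ℂ) (ω : Matrix a a ℂ) :
    ((ω ⊗ₖ ρB) * (Uᴴ * (W ⊗ₖ (1 : Matrix b' b' ℂ)) * U)).trace = (W * E ω).trace := by
  rw [hEU, ← trace_kronecker_one_mul, ← Matrix.mul_assoc, Matrix.trace_mul_comm,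
    Matrix.trace_mul_comm (W ⊗ₖ _)]
  simp only [Matrix.mul_assoc]

variable [Fintype a] [DecidableEq a] [Fintype b] [DecidableEq b] [DecidableEq b']

/-- Identifies `Y` as the marginal of `Z` in the state `ρB`. -/
theorem trace_kronecker_mul_fluctuation {XA : Matrix a a ℂ} {XA' : Matrix a' a' ℂ}
    {U : Matrix (a' × b') (a × b) ℂ} {ρB : Matrix b b ℂ} (hρB : IsState ρB)
    {E : Matrix a a ℂ →ₗ[ℂ] Matrix a' a' ℂ}
    (hEU : ∀ ω : Matrix a a ℂ, E ω = partialTraceRight (U * (ω ⊗ₖ ρB) * Uᴴ))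
    (ω : Matrix a a ℂ) :
    ((ω ⊗ₖ ρB) * (XA ⊗ₖ (1 : Matrix b b ℂ) -
      Uᴴ * (XA' ⊗ₖ (1 : Matrix b' b' ℂ)) * U)).trace = (ω * (XA - dualMap E XA')).trace := by
  rw [Matrix.mul_sub, Matrix.trace_sub, trace_kronecker_mul_heisenberg hEU,
    ← Matrix.mul_kronecker_mul, Matrix.mul_one, Matrix.trace_kronecker, hρB.trace_eq_one, mul_one,
    ← trace_dualMap_mul, Matrix.mul_sub, Matrix.trace_sub, Matrix.trace_mul_comm ω (dualMap E XA')]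

variable [DecidableEq a']

/-- The point is boundedness, without which the real supremum would be the default value `0`: `4
Tr(Z²)` bounds the Fisher information for all states at once. -/
theorem sqrt_qfi_le_maxFluctuation {XA : Matrix a a ℂ} {XA' : Matrix a' a' ℂ}
    {U : Matrix (a' × b') (a × b) ℂ} {ρB : Matrix b b ℂ} {ρ : K → Matrix a a ℂ}
    (hXA : XA.IsHermitian) (hXA' : XA'.IsHermitian) (hρB : IsState ρB) {σ : Matrix a a ℂ}
    (hσ : IsState σ) (hσS : LinearMap.range σ.mulVecLin ≤ supportSpan ρ) :
    √(qfi (σ ⊗ₖ ρB) (XA ⊗ₖ (1 : Matrix b b ℂ) - Uᴴ * (XA' ⊗ₖ (1 : Matrix b' b' ℂ)) * U)) ≤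
      maxFluctuation XA XA' U ρB ρ := by
  have hZ := isHermitian_fluctuation (b := b) U hXA hXA'
  refine le_csSup ?_ ⟨σ, hσ, hσS, rfl⟩
  set Z := XA ⊗ₖ (1 : Matrix b b ℂ) - Uᴴ * (XA' ⊗ₖ (1 : Matrix b' b' ℂ)) * U
  have hZZ : (Z * Z).PosSemidef := by
    have := Matrix.posSemidef_conjTranspose_mul_self Z
    rwa [hZ.eq] at this
  refine ⟨√(4 * (Z * Z).trace.re), ?_⟩
  rintro _ ⟨τ, hτ, -, rfl⟩
  have hs := isState_kronecker hτ hρB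
  exact Real.sqrt_le_sqrt ((qfi_le hs.posSemidef hZ).trans
    (mul_le_mul_of_nonneg_left (re_trace_state_mul_le_trace hs hZZ) (by norm_num)))

/-- The bound for a pair of test states and a recovery channel, in terms of an effect `M` which
separates the positive and the negative part of the difference of the test states. -/
theorem re_trace_pair_le_of_recovery
    {XA : Matrix a a ℂ} {XB : Matrix b b ℂ} {XA' : Matrix a' a' ℂ} {XB' : Matrix b' b' ℂ}
    (hXA : XA.IsHermitian) (hXB : XB.IsHermitian) (hXA' : XA'.IsHermitian)
    {U : Matrix (a' × b') (a × b) ℂ} (hU : Uᴴ * U = 1) (hU' : U * Uᴴ = 1)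
    {ρB : Matrix b b ℂ} (hρB : IsState ρB)
    {E : Matrix a a ℂ →ₗ[ℂ] Matrix a' a' ℂ}
    (hEU : ∀ ω : Matrix a a ℂ, E ω = partialTraceRight (U * (ω ⊗ₖ ρB) * Uᴴ))
    (hcons : XA ⊗ₖ (1 : Matrix b b ℂ) + (1 : Matrix a a ℂ) ⊗ₖ XB
      = Uᴴ * (XA' ⊗ₖ (1 : Matrix b' b' ℂ) + (1 : Matrix a' a' ℂ) ⊗ₖ XB') * U)
    {ρ : K → Matrix a a ℂ} (hρ : ∀ k, IsState (ρ k))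
    {R : Matrix a' a' ℂ →ₗ[ℂ] Matrix a a ℂ} (hR : IsChannel R) (k k' : K)
    {M : Matrix a a ℂ} (hM : M.PosSemidef) (hM1 : (1 - M).PosSemidef)
    (hMP : M * (ρ k - ρ k')⁺ = (ρ k - ρ k')⁺) (hPM : (ρ k - ρ k')⁺ * M = (ρ k - ρ k')⁺)
    (hMN : M * (ρ k - ρ k')⁻ = 0) (hNM : (ρ k - ρ k')⁻ * M = 0) :
    ((ρ k - ρ k')⁺ * (XA - dualMap E XA') * (ρ k - ρ k')⁻ * (XA - dualMap E XA')).trace.re ≤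
      (maxFluctuation XA XA' U ρB ρ + √(qfi ρB XB)) ^ 2 * (traceDist (ρ k) (ρ k') *
        (((ρ k - R (E (ρ k))) * M).trace.re + ((R (E (ρ k')) - ρ k') * M).trace.re) / 2) := by
  have hZ := isHermitian_fluctuation (b := b) U hXA hXA'
  set S₁ := dualMap R M with hS₁
  have hS : S₁.PosSemidef := hR.posSemidef_dualMap hM
  have hS1 : (1 - S₁).PosSemidef := by
    rw [hS₁, hR.one_sub_dualMap]
    exact hR.posSemidef_dualMap hM1
  -- The effect of evolving by `U`, recovering from `A'` by `R`, and measuring `M`.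
  set G := Uᴴ * (S₁ ⊗ₖ (1 : Matrix b' b' ℂ)) * U with hGdef
  have hG : G.PosSemidef := (hS.kronecker Matrix.PosSemidef.one).conjTranspose_mul_mul_same U
  have hG1 : (1 - G).PosSemidef := by
    have h := (hS1.kronecker
      (Matrix.PosSemidef.one (n := b') (R := ℂ))).conjTranspose_mul_mul_same U
    have e : (1 - S₁) ⊗ₖ (1 : Matrix b' b' ℂ) = 1 - S₁ ⊗ₖ (1 : Matrix b' b' ℂ) := by
      rw [eq_sub_iff_add_eq, ← Matrix.add_kronecker, sub_add_cancel, Matrix.one_kronecker_one]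
    rwa [e, Matrix.mul_sub, Matrix.sub_mul, Matrix.mul_one, hU] at h
  have hcomm : (XA ⊗ₖ (1 : Matrix b b ℂ) - Uᴴ * (XA' ⊗ₖ (1 : Matrix b' b' ℂ)) * U +
      (1 : Matrix a a ℂ) ⊗ₖ XB) * G = G * (XA ⊗ₖ (1 : Matrix b b ℂ) -
      Uᴴ * (XA' ⊗ₖ (1 : Matrix b' b' ℂ)) * U + (1 : Matrix a a ℂ) ⊗ₖ XB) := by
    -- By conservation the operator is the evolved `1 ⊗ X_{B'}`, which acts on `B'` alone, while `G`
    -- is evolved from an effect on `A'`.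
    have e : XA ⊗ₖ (1 : Matrix b b ℂ) - Uᴴ * (XA' ⊗ₖ (1 : Matrix b' b' ℂ)) * U +
        (1 : Matrix a a ℂ) ⊗ₖ XB = Uᴴ * ((1 : Matrix a' a' ℂ) ⊗ₖ XB') * U := by
      rw [sub_add_eq_add_sub, hcons, Matrix.mul_add, Matrix.add_mul, add_sub_cancel_left]
    have hmul : ∀ V W : Matrix (a' × b') (a' × b') ℂ,
        (Uᴴ * V * U) * (Uᴴ * W * U) = Uᴴ * (V * W) * U := by
      intro V W
      calc (Uᴴ * V * U) * (Uᴴ * W * U) = Uᴴ * V * (U * Uᴴ) * W * U := by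
            simp only [Matrix.mul_assoc]
        _ = _ := by rw [hU', Matrix.mul_one, Matrix.mul_assoc Uᴴ]
    rw [e, hGdef, hmul, hmul, ← Matrix.mul_kronecker_mul, ← Matrix.mul_kronecker_mul]
    simp only [Matrix.one_mul, Matrix.mul_one]
  refine (re_trace_posPart_negPart_le (hρ k) (hρ k')
    (le_iSup (fun k => LinearMap.range (ρ k).mulVecLin) k)
    (le_iSup (fun k => LinearMap.range (ρ k).mulVecLin) k') hρB hZ hXB hG hG1 hM.1
    (fun σ hσ hσS => sqrt_qfi_le_maxFluctuation hXA hXA' hρB hσ hσS)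
    (trace_kronecker_mul_fluctuation hρB hEU) hcomm hMP hPM hMN hNM).trans_eq ?_
  rw [hGdef, trace_kronecker_mul_heisenberg hEU, hS₁, trace_dualMap_mul, map_sub, map_sub,
    Matrix.trace_mul_comm M]
  simp only [Matrix.sub_mul, Matrix.trace_sub, Complex.sub_re]
  ring

end Recovery

end QSI

/-! ### Assembly of the bounds -/

open QSI

theorem mainTheorem1
    {a b a' b' K : Type*}
    [Fintype a] [DecidableEq a] [Fintype b] [DecidableEq b]
    [Fintype a'] [DecidableEq a'] [Fintype b'] [DecidableEq b']
    [Fintype K] [DecidableEq K]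
    -- conserved quantities
    (XA : Matrix a a ℂ) (XB : Matrix b b ℂ) (XA' : Matrix a' a' ℂ) (XB' : Matrix b' b' ℂ)
    (hXA : XA.IsHermitian) (hXB : XB.IsHermitian)
    (hXA' : XA'.IsHermitian) (hXB' : XB'.IsHermitian)
    -- unitary from `A ⊗ B` to `A' ⊗ B'` and the environment state
    (U : Matrix (a' × b') (a × b) ℂ) (hU : Uᴴ * U = 1) (hU' : U * Uᴴ = 1)
    (ρB : Matrix b b ℂ) (hρB : QSI.IsState ρB)
    -- the channel, its implementation and the conservation law
    (E : Matrix a a ℂ →ₗ[ℂ] Matrix a' a' ℂ) (hE : QSI.IsChannel E)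
    (hEU : ∀ ω : Matrix a a ℂ, E ω = QSI.partialTraceRight (U * (ω ⊗ₖ ρB) * Uᴴ))
    (hcons : XA ⊗ₖ (1 : Matrix b b ℂ) + (1 : Matrix a a ℂ) ⊗ₖ XB
      = Uᴴ * (XA' ⊗ₖ (1 : Matrix b' b' ℂ) + (1 : Matrix a' a' ℂ) ⊗ₖ XB') * U)
    -- the test ensemble
    (p : K → ℝ) (hp : ∀ k, 0 ≤ p k) (hp1 : ∑ k, p k = 1)
    (ρ : K → Matrix a a ℂ) (hρ : ∀ k, QSI.IsState (ρ k))
    -- the quantities in the bounds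
    (Y : Matrix a a ℂ) (hY : Y = XA - QSI.dualMap E XA')
    (C Δ F δ δT Tbar pmin : ℝ)
    (hC : C = QSI.offDiagSum p ρ Y)
    (hΔ : Δ = QSI.maxFluctuation XA XA' U ρB ρ)
    (hF : F = QSI.qfi ρB XB)
    (hδ : δ = QSI.irreversibility E p ρ)
    (hδT : δT = QSI.traceIrreversibility E p ρ)
    (hTbar : Tbar = QSI.avgTraceDist p ρ)
    (hpmin : pmin = ⨅ k, p k) :
    C / (Δ + √F) ≤ √(δ * Tbar) ∧
    C / (Δ + √F) ≤ √(δT * (1 - pmin)) ∧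
    ((∀ k k', k ≠ k' → QSI.fidelity (ρ k) (ρ k') = 0) →
      C / (Δ + √F) ≤ δ * √(1 - pmin)) ∧
    Tbar ≤ 1 ∧
    C / (Δ + √F) ≤ √δ ∧
    ((∀ k k', k ≠ k' → QSI.fidelity (ρ k) (ρ k') = 0) → C / (Δ + √F) ≤ δ) ∧
    (Δ + √F = 0 → C = 0) := by
  subst hY hC hΔ hF hδ hδT hTbar hpmin
  have hK : Nonempty K := by
    by_contra h
    rw [not_nonempty_iff] at h
    simp at hp1
  obtain ⟨k₀⟩ := hK
  set Γ := maxFluctuation XA XA' U ρB ρ + √(qfi ρB XB)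
  set pmin := ⨅ k, p k
  have hpmin : ∀ k, pmin ≤ p k := fun k => ciInf_le (Set.finite_range p).bddBelow k
  have hpmin0 : 0 ≤ pmin := Real.iInf_nonneg hp
  have hple : ∀ k, p k ≤ 1 := fun k => by
    rw [← hp1]
    exact Finset.single_le_sum (fun i _ => hp i) (Finset.mem_univ k)
  have hpmin1 : 0 ≤ 1 - pmin := sub_nonneg.2 ((hpmin k₀).trans (hple k₀))
  have hΓ : 0 ≤ Γ := add_nonneg (Real.sSup_nonneg (by
    rintro _ ⟨σ, -, -, rfl⟩
    exact Real.sqrt_nonneg _)) (Real.sqrt_nonneg _)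
  -- Some recovery channel exists, so the infima defining `δ` and `δ_T` range over nonempty sets.
  obtain ⟨R₀, hR₀⟩ := exists_isChannel (m := a') (hρ k₀)
  set Y := XA - dualMap E XA'
  set s := ∑ q ∈ (Finset.univ : Finset K).offDiag,
    p q.1 * p q.2 * ((ρ q.1 - ρ q.2)⁺ * Y * (ρ q.1 - ρ q.2)⁻ * Y).trace.re with hs
  have hCs : offDiagSum p ρ Y = √s := rfl
  have hT0 : ∀ k k', 0 ≤ traceDist (ρ k) (ρ k') := fun k k' => traceDist_nonneg (hρ k) (hρ k')
  have hT1 : ∀ k k', traceDist (ρ k) (ρ k') ≤ 1 := fun k k' => traceDist_le_one (hρ k) (hρ k')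
  have sum_le : ∀ f : K × K → ℝ,
      (∀ k k', k ≠ k' → ((ρ k - ρ k')⁺ * Y * (ρ k - ρ k')⁻ * Y).trace.re ≤ Γ ^ 2 * f (k, k')) →
      s ≤ Γ ^ 2 * ∑ q ∈ (Finset.univ : Finset K).offDiag, p q.1 * p q.2 * f q := by
    intro f hf
    rw [hs, Finset.mul_sum]
    refine Finset.sum_le_sum fun q hq => ?_
    have := mul_le_mul_of_nonneg_left (hf q.1 q.2 (Finset.mem_offDiag.1 hq).2.2)
      (mul_nonneg (hp q.1) (hp q.2))
    linarith
  have hRs : ∀ {R : Matrix a' a' ℂ →ₗ[ℂ] Matrix a a ℂ}, IsChannel R → ∀ k,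
      IsState (R (E (ρ k))) := fun hR k => hR.isState (hE.isState (hρ k))
  have pair : ∀ R : Matrix a' a' ℂ →ₗ[ℂ] Matrix a a ℂ, IsChannel R → ∀ k k',
      ((ρ k - ρ k')⁺ * Y * (ρ k - ρ k')⁻ * Y).trace.re ≤ Γ ^ 2 * (traceDist (ρ k) (ρ k') *
        (traceDist (ρ k) (R (E (ρ k))) + traceDist (ρ k') (R (E (ρ k')))) / 2) := by
    intro R hR k k'
    obtain ⟨M, hM, hM2, h1, h2, h3, h4, -⟩ := exists_proj_traceDist (hρ k) (hρ k')
    have hMp := posSemidef_of_proj hM hM2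
    have hM1 := posSemidef_one_sub_proj hM hM2
    refine (re_trace_pair_le_of_recovery hXA hXB hXA' hU hU' hρB hEU hcons hρ hR k k'
      hMp hM1 h1 h2 h3 h4).trans (mul_le_mul_of_nonneg_left ?_ (sq_nonneg Γ))
    have h5 := re_trace_sub_mul_le_traceDist (hρ k) (hRs hR k) hMp hM1
    have h6 := re_trace_sub_mul_le_traceDist (hRs hR k') (hρ k') hMp hM1
    rw [traceDist_comm _ (ρ k')] at h6
    have := mul_le_mul_of_nonneg_left (add_le_add h5 h6) (hT0 k k')
    linarith
  have hTbar1 : avgTraceDist p ρ ≤ 1 := by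
    refine Real.sqrt_le_one.2 ?_
    calc ∑ k, ∑ k', p k * p k' * traceDist (ρ k) (ρ k') ^ 2 ≤ ∑ k, ∑ k', p k * p k' :=
          Finset.sum_le_sum fun k _ => Finset.sum_le_sum fun k' _ =>
            mul_le_of_le_one_right (mul_nonneg (hp k) (hp k'))
              (pow_le_one₀ (hT0 k k') (hT1 k k'))
      _ = 1 := by simp only [← Finset.mul_sum, hp1, mul_one]
  have hTbar0 : 0 ≤ avgTraceDist p ρ := Real.sqrt_nonneg _
  have hδ0 : 0 ≤ irreversibility E p ρ := Real.sInf_nonneg (by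
    rintro _ ⟨R, -, rfl⟩
    exact Real.sqrt_nonneg _)
  have boundδ : s ≤ Γ ^ 2 * avgTraceDist p ρ * irreversibility E p ρ := by
    rw [irreversibility]
    refine le_mul_sInf ?_ (mul_nonneg (sq_nonneg _) hTbar0) ?_
    · exact ⟨_, R₀, hR₀, rfl⟩
    rintro _ ⟨R, hR, rfl⟩
    refine (sum_le (fun q => traceDist (ρ q.1) (ρ q.2) * (traceDist (ρ q.1) (R (E (ρ q.1))) +
      traceDist (ρ q.2) (R (E (ρ q.2)))) / 2) fun k k' _ => pair R hR k k').trans ?_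
    rw [mul_assoc]
    refine mul_le_mul_of_nonneg_left ?_ (sq_nonneg _)
    refine (sum_offDiag_le_sqrt_mul_sqrt hp hp1
      (fun k => traceDist_nonneg (hρ k) (hRs hR k)) hT0
      (fun k k' => traceDist_comm (ρ k) (ρ k'))).trans ?_
    rw [mul_comm]
    refine mul_le_mul_of_nonneg_left (Real.sqrt_le_sqrt ?_) hTbar0
    refine Finset.sum_le_sum fun k _ => mul_le_mul_of_nonneg_left ?_ (hp k)
    rw [purifiedDist_sq (hρ k) (hRs hR k)]
    exact traceDist_sq_le (hρ k) (hRs hR k)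
  have boundT : s ≤ Γ ^ 2 * (1 - pmin) * traceIrreversibility E p ρ := by
    rw [traceIrreversibility]
    refine le_mul_sInf ?_ (mul_nonneg (sq_nonneg _) hpmin1) ?_
    · exact ⟨_, R₀, hR₀, rfl⟩
    rintro _ ⟨R, hR, rfl⟩
    have he : ∀ k, 0 ≤ traceDist (ρ k) (R (E (ρ k))) :=
      fun k => traceDist_nonneg (hρ k) (hRs hR k)
    refine (sum_le (fun q => (traceDist (ρ q.1) (R (E (ρ q.1))) +
      traceDist (ρ q.2) (R (E (ρ q.2)))) / 2) fun k k' _ => (pair R hR k k').trans ?_).trans ?_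
    · refine mul_le_mul_of_nonneg_left ?_ (sq_nonneg _)
      have := mul_le_mul_of_nonneg_right (hT1 k k') (add_nonneg (he k) (he k'))
      dsimp only
      linarith
    · rw [mul_assoc]
      exact mul_le_mul_of_nonneg_left (sum_offDiag_le_one_sub_mul hp hp1 he hpmin) (sq_nonneg _)
  have boundOrth : (∀ k k', k ≠ k' → fidelity (ρ k) (ρ k') = 0) →
      √s ≤ Γ * √(1 - pmin) * irreversibility E p ρ := by
    intro horth
    rw [irreversibility]
    refine le_mul_sInf ?_ (mul_nonneg hΓ (Real.sqrt_nonneg _)) ?_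
    · exact ⟨_, R₀, hR₀, rfl⟩
    rintro _ ⟨R, hR, rfl⟩
    rw [mul_assoc, ← Real.sqrt_mul hpmin1, Real.sqrt_le_left (mul_nonneg hΓ (Real.sqrt_nonneg _)),
      mul_pow, Real.sq_sqrt (mul_nonneg hpmin1 (Finset.sum_nonneg fun k _ =>
        mul_nonneg (hp k) (sq_nonneg _)))]
    refine (sum_le (fun q => (purifiedDist (ρ q.1) (R (E (ρ q.1))) ^ 2 +
      purifiedDist (ρ q.2) (R (E (ρ q.2))) ^ 2) / 2) fun k k' hkk => ?_).trans
      (mul_le_mul_of_nonneg_left (sum_offDiag_le_one_sub_mul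
        (e := fun k => purifiedDist (ρ k) (R (E (ρ k))) ^ 2) hp hp1 (fun k => sq_nonneg _) hpmin)
        (sq_nonneg _))
    obtain ⟨M, hM, hM2, h1, h2, h3, h4, h5⟩ := exists_proj_traceDist (hρ k) (hρ k')
    have hMp := posSemidef_of_proj hM hM2
    have hM1 := posSemidef_one_sub_proj hM hM2
    refine (re_trace_pair_le_of_recovery hXA hXB hXA' hU hU' hρB hEU hcons hρ hR k k'
      hMp hM1 h1 h2 h3 h4).trans (mul_le_mul_of_nonneg_left ?_ (sq_nonneg Γ))
    -- Orthogonality makes `ρ k` and `ρ k'` themselves the positive and negative parts, so `M` fixes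
    -- the first and annihilates the second.
    obtain ⟨hPk, hNk⟩ := CFC.posPart_negPart_unique (a := ρ k - ρ k') rfl
      (mul_eq_zero_of_fidelity_eq_zero (hρ k).posSemidef (hρ k').posSemidef (horth k k' hkk))
      (hρ k).posSemidef.nonneg (hρ k').posSemidef.nonneg
    rw [hPk] at h2
    rw [hNk] at h4
    have h6 := fidelity_sq_le_of_proj (hρ k) (hRs hR k) hM hM2 h2
    -- For `ρ k'` the certain outcome is `1 - M`.
    have h7 := fidelity_sq_le_of_proj (Q := 1 - M) (hρ k') (hRs hR k') hM1.1
      (by simp [Matrix.sub_mul, Matrix.mul_sub, hM2]) (by rw [Matrix.mul_sub, h4]; simp)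
    rw [re_trace_mul_one_sub (hRs hR k')] at h7
    have h8 : ((ρ k - R (E (ρ k))) * M).trace.re ≤ purifiedDist (ρ k) (R (E (ρ k))) ^ 2 := by
      rw [purifiedDist_sq (hρ k) (hRs hR k), Matrix.sub_mul, Matrix.trace_sub, Complex.sub_re, h2,
        (hρ k).trace_eq_one, Complex.one_re]
      linarith
    have h9 : ((R (E (ρ k')) - ρ k') * M).trace.re ≤
        purifiedDist (ρ k') (R (E (ρ k'))) ^ 2 := by
      rw [purifiedDist_sq (hρ k') (hRs hR k'), Matrix.sub_mul, Matrix.trace_sub, Complex.sub_re, h4,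
        Matrix.trace_zero, Complex.zero_re]
      linarith
    have h10 : traceDist (ρ k) (ρ k') = 1 := by
      rw [← h5, Matrix.sub_mul, h2, h4, sub_zero, (hρ k).trace_eq_one, Complex.one_re]
    rw [h10, one_mul]
    linarith
  have sqrt_le : ∀ {t : ℝ}, s ≤ Γ ^ 2 * t → √s ≤ Γ * √t := by
    intro t h
    calc √s ≤ √(Γ ^ 2 * t) := Real.sqrt_le_sqrt h
      _ = Γ * √t := by rw [Real.sqrt_mul (sq_nonneg _), Real.sqrt_sq hΓ]
  rw [hCs]
  have main1 : √s ≤ Γ * √(irreversibility E p ρ * avgTraceDist p ρ) :=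
    sqrt_le (by linarith)
  -- The case `Γ = 0` is included, since division by zero gives `0`.
  have c1 : √s / Γ ≤ √(irreversibility E p ρ * avgTraceDist p ρ) :=
    div_le_of_le_mul₀ hΓ (Real.sqrt_nonneg _) (by linarith)
  have c3 : (∀ k k', k ≠ k' → fidelity (ρ k) (ρ k') = 0) →
      √s / Γ ≤ irreversibility E p ρ * √(1 - pmin) := fun h =>
    div_le_of_le_mul₀ hΓ (mul_nonneg hδ0 (Real.sqrt_nonneg _)) (by linarith [boundOrth h])
  refine ⟨c1, ?_, c3, hTbar1, ?_, fun h => ?_, fun h => ?_⟩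
  · have := sqrt_le (t := traceIrreversibility E p ρ * (1 - pmin)) (by linarith)
    exact div_le_of_le_mul₀ hΓ (Real.sqrt_nonneg _) (by linarith)
  · exact c1.trans (Real.sqrt_le_sqrt (mul_le_of_le_one_right hδ0 hTbar1))
  · refine (c3 h).trans (mul_le_of_le_one_right hδ0 ?_)
    exact Real.sqrt_le_one.2 (by linarith)
  · rw [h, zero_mul] at main1
    exact le_antisymm main1 (Real.sqrt_nonneg _)
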